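/- **Setting.** Let $A\in\mathbb{R}^{n\times n}$ and $C\in\mathbb{R}^{m\times n}$ be such that $(C,A)$ is observable and $A$ has at least one (complex) eigenvalue of modulus greater than $1$. Consider the system $$X(t+1)=AX(t)+V(t),\qquad Y(t)=CX(t)+W(t),\qquad t=0,1,2,\dots$$ *Channel.* Let $\mathcal X$ be a finite alphabet with $q=|\mathcal X|\ge 2$, and let $\log$ be the logarithm to base $q$. A finite-state erasure channel is given by a directed graph $(\mathcal S,\mathcal E)$, $\mathcal E\subseteq\mathcal S\times\mathcal S$, on a finite nonempty state set $\mathcal S$, which is strongly connected (there is a walk with at least one edge from any state to any state), and by a label $v\in\{0,1\}$ on each edge such that distinct edges leaving the same state have distinct labels. Its noise sequences are the label sequences $(z(t))_{t\ge0}$ of the infinite walks in the graph, from any initial state. For the input $D(t)\in\mathcal X$ the output is $Q(t)=D(t)$ if $z(t)=0$ and $Q(t)=*$ (erasure) if $z(t)=1$. Let $h_{ch}=\log\lambda$, where $\lambda$ is the Perron eigenvalue (spectral radius) of the $0$–$1$ adjacency matrix of the graph, and let the maximal ratio $\tau$ be the maximum, over all cycles of the graph, of the number of edges labelled $1$ divided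 by the number of edges of the cycle. Let $h_{lin}=\sum_{|\lambda_i|\ge1}\log|\lambda_i|$, summed over the eigenvalues of $A$ with algebraic multiplicity. *Coder-estimators.* A coder-estimator consists of arbitrary maps giving $D(t)=\zeta(t,Y(0),\dots,Y(t))\in\mathcal X$ and $\hat X(t+1)=\eta(t,Q(0),\dots,Q(t))\in\mathbb{R}^n$, with $\hat X(0)=0$. The initial state, the signals $V$, $W$ and the channel noise are mutually unrelated, that is, their joint range is the Cartesian product of their ranges. A coder-estimator yields *uniformly bounded estimation errors* if for any ranges of $V$ and $W$ (sets of sequences) that are bounded uniformly in time there is $l>0$ such that for any range of $X(0)$ contained in the ball $\mathbf B_l=\{x:\|x\|\le l\}$ the supremum of $\|\hat X(t)-X(t)\|$ over all $t\ge0$ and all realizations of initial state, noises and channel noise is finite. **Proposition.** 1. If $h_{lin}+h_{ch}+\tau<1$, then there is a coder-estimator that yields uniformly bounded estimation errors. 2. Conversely, suppose $h_{lin}+\tau>1$. Then for any uniformly bounded ranges of $V$ and of $W$ that contain the zero sequence there are noise sequences $v$ and $w$ in these ranges such that for every coder-estimator and every $l>0$ there are an initial state $x_0\in\mathbf B_l$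 and a channel noise sequence for which the estimation error $\|\hat X(t)-X(t)\|$ is unbounded in $t$. -/

import Mathlib

open scoped Matrix

noncomputable section

/-- A finite-state machine on the state set `S` that governs the erasure noise `v(t) ∈ {0, 1}`
(`true` stands for `1`, an erasure). `edge` is the edge set of the state transition graph, and
`noise s s'` is the noise value on the edge `(s, s')`; its values off the edge set are never used.
Different edges leaving a state carry different noise values, and any state can be reached from
any state by a walk with at least one edge. -/
structure FiniteStateErasureChannel (S : Type*) where
  edge : S → S → Prop
  noise : S → S → Bool
  noise_injective : ∀ s s₁ s₂, edge s s₁ → edge s s₂ → noise s s₁ = noise s s₂ → s₁ = s₂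
  stronglyConnected : ∀ s s', Relation.TransGen edge s s'

namespace FiniteStateErasureChannel

variable {S : Type*}

/-- The range of the channel noise: the label sequences of the infinite walks in the state
transition graph, with an arbitrary initial state. -/
def noiseSequences (ch : FiniteStateErasureChannel S) : Set (ℕ → Bool) :=
  {z | ∃ s : ℕ → S, ∀ t, ch.edge (s t) (s (t + 1)) ∧ z t = ch.noise (s t) (s (t + 1))}

open Classical in
/-- The 0-1 adjacency matrix of the state transition graph. -/
def adjacencyMatrix (ch : FiniteStateErasureChannel S) : Matrix S S ℂ :=
  Matrix.of fun s s' => if ch.edge s s' then 1 else 0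

open Classical in
/-- The topological entropy `log_q λ`, where `λ` is the Perron eigenvalue (the largest modulus of
an eigenvalue) of the adjacency matrix. -/
def topologicalEntropy [Fintype S] (ch : FiniteStateErasureChannel S) (q : ℕ) : ℝ :=
  Real.logb q (spectralRadius ℂ ch.adjacencyMatrix).toReal

/-- `p 0, …, p k` are the distinct vertices of a cycle with `k + 1` edges. The addition is that of
`Fin (k + 1)`, so the successor of `p k` is `p 0`; for `k = 0` the cycle is a loop. -/
def IsCycle (ch : FiniteStateErasureChannel S) {k : ℕ} (p : Fin (k + 1) → S) : Prop :=
  Function.Injective p ∧ ∀ i, ch.edge (p i) (p (i + 1))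

/-- The number of erasure edges of a cycle divided by its number of edges. -/
def cycleRatio (ch : FiniteStateErasureChannel S) {k : ℕ} (p : Fin (k + 1) → S) : ℝ :=
  ((Finset.univ.filter fun i => ch.noise (p i) (p (i + 1)) = true).card : ℝ) / ((k + 1 : ℕ) : ℝ)

/-- The maximal ratio of erasure edges over all cycles. -/
def maximalRatio (ch : FiniteStateErasureChannel S) : ℝ :=
  sSup {r | ∃ (k : ℕ) (p : Fin (k + 1) → S), ch.IsCycle p ∧ r = ch.cycleRatio p}

end FiniteStateErasureChannel

/-- The output of an erasure channel for a given input symbol and noise value; `none` is the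
erasure symbol. -/
def erasureOutput {X : Type*} (x : X) (v : Bool) : Option X :=
  if v = true then none else some x

namespace LTI

variable {n m : ℕ}

/-- The Kalman observability matrix, with the blocks `C, C A, …, C A ^ (n - 1)`. -/
def observabilityMatrix (C : Matrix (Fin m) (Fin n) ℝ) (A : Matrix (Fin n) (Fin n) ℝ) :
    Matrix (Fin n × Fin m) (Fin n) ℝ :=
  Matrix.of fun ki j => (C * A ^ (ki.1 : ℕ)) ki.2 j

/-- The pair `(C, A)` is observable. -/
def Observable (C : Matrix (Fin m) (Fin n) ℝ) (A : Matrix (Fin n) (Fin n) ℝ) : Prop :=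
  (observabilityMatrix C A).rank = n

/-- The complex eigenvalues of `A` with their algebraic multiplicities. -/
def eigenvalues (A : Matrix (Fin n) (Fin n) ℝ) : Multiset ℂ :=
  (A.map (algebraMap ℝ ℂ)).charpoly.roots

/-- The topological entropy of the linear system: the sum of `log_q |λ|` over the eigenvalues `λ`
with `|λ| ≥ 1`. -/
def topologicalEntropy (A : Matrix (Fin n) (Fin n) ℝ) (q : ℕ) : ℝ :=
  (((eigenvalues A).filter fun z => 1 ≤ ‖z‖).map fun z => Real.logb q ‖z‖).sum

/-- `X(0) = x₀`, `X(t + 1) = A X(t) + V(t)`. -/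
def state (A : Matrix (Fin n) (Fin n) ℝ) (x₀ : Fin n → ℝ) (v : ℕ → Fin n → ℝ) :
    ℕ → Fin n → ℝ
  | 0 => x₀
  | t + 1 => A *ᵥ state A x₀ v t + v t

/-- `Y(t) = C X(t) + W(t)`. -/
def output (A : Matrix (Fin n) (Fin n) ℝ) (C : Matrix (Fin m) (Fin n) ℝ) (x₀ : Fin n → ℝ)
    (v : ℕ → Fin n → ℝ) (w : ℕ → Fin m → ℝ) (t : ℕ) : Fin m → ℝ :=
  C *ᵥ state A x₀ v t + w t

/-- A set of signals (the range of a noise signal) that is bounded uniformly in time. -/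
def UniformlyBoundedSignals {k : ℕ} (R : Set (ℕ → Fin k → ℝ)) : Prop :=
  ∃ M : ℝ, ∀ r ∈ R, ∀ t, ‖r t‖ ≤ M

end LTI

/-- A causal coder-estimator: the channel input `D(t) = encode t (Y(0), …, Y(t))`, and the
prediction `X̂(t + 1) = estimate t (Q(0), …, Q(t))` from the channel outputs. -/
structure CoderEstimator (n m : ℕ) (X : Type*) where
  encode : (t : ℕ) → (Fin (t + 1) → Fin m → ℝ) → X
  estimate : (t : ℕ) → (Fin (t + 1) → Option X) → Fin n → ℝ

namespace CoderEstimator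

variable {n m : ℕ} {X : Type*}

/-- The channel output `Q(t)` for the measurement signal `y` and the channel noise `z`. -/
def received (ce : CoderEstimator n m X) (y : ℕ → Fin m → ℝ) (z : ℕ → Bool) (t : ℕ) : Option X :=
  erasureOutput (ce.encode t fun i => y i) (z t)

/-- The state estimate `X̂(t)`, with `X̂(0) = 0`. -/
def stateEstimate (ce : CoderEstimator n m X) (y : ℕ → Fin m → ℝ) (z : ℕ → Bool) :
    ℕ → Fin n → ℝ
  | 0 => 0
  | t + 1 => ce.estimate t fun i => ce.received y z i

/-- The estimation error `X̂(t) - X(t)`, for the initial state `x₀`, the process noise `v`, the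
measurement noise `w` and the channel noise `z`. -/
def estimationError (ce : CoderEstimator n m X) (A : Matrix (Fin n) (Fin n) ℝ)
    (C : Matrix (Fin m) (Fin n) ℝ) (x₀ : Fin n → ℝ) (v : ℕ → Fin n → ℝ) (w : ℕ → Fin m → ℝ)
    (z : ℕ → Bool) (t : ℕ) : Fin n → ℝ :=
  ce.stateEstimate (LTI.output A C x₀ v w) z t - LTI.state A x₀ v t

/-- Uniformly bounded estimation errors: for any uniformly bounded noise ranges `RV`, `RW` there is
`l > 0` such that for any range `RX` of the initial state in the `l`-ball the error is bounded over
all times and all realizations. The initial state, the two noise signals and the channel noise are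
mutually unrelated, so their realizations range independently over `RX`, `RV`, `RW` and
`ch.noiseSequences`. -/
def UniformlyBoundedErrors {S : Type*} (ce : CoderEstimator n m X) (A : Matrix (Fin n) (Fin n) ℝ)
    (C : Matrix (Fin m) (Fin n) ℝ) (ch : FiniteStateErasureChannel S) : Prop :=
  ∀ (RV : Set (ℕ → Fin n → ℝ)) (RW : Set (ℕ → Fin m → ℝ)),
    LTI.UniformlyBoundedSignals RV → LTI.UniformlyBoundedSignals RW →
    ∃ l : ℝ, 0 < l ∧ ∀ RX : Set (Fin n → ℝ), RX ⊆ Metric.closedBall 0 l →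
      ∃ K : ℝ, ∀ x₀ ∈ RX, ∀ v ∈ RV, ∀ w ∈ RW, ∀ z ∈ ch.noiseSequences, ∀ t,
        ‖ce.estimationError A C x₀ v w z t‖ ≤ K

end CoderEstimator

end

-- Let Λ be the product of max(1, |λ_i|) over the eigenvalues of A, so that h_lin = log Λ, and let λ
-- be the Perron eigenvalue of the channel. Both parts compare exponential counts over a long time
-- T.
--
-- Direct part. The hypothesis says Λ λ q^τ < q; fix R > Λ with R λ q^τ < q. For arbitrarily large
-- T, the image of the unit ball under A^T is covered by O(R^T) balls of radius 1/2
-- (`LTI.exists_finset_cover_pow`). The channel has at most about λ^T noise words of length T, each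
-- with at most τT + |S| erasures (`erasures_le`). A greedy code of length T therefore has at least
-- about (q / (λ q^τ))^T words that no noise word can confuse (`eventually_exists_zeroErrorCode`).
-- This exceeds the number of balls by more than one, so every block carries, without error, either
-- the index of a ball or an overflow symbol. With this information a zooming quantizer keeps a
-- bounded error although the noise bounds are unknown to it (`ZoomQuantizer.exists_bound`). By
-- observability, n consecutive outputs determine the state up to a bounded error, and the quantizer
-- is applied to this observed state.
--
-- Converse. Take zero noises and let the channel run round a cycle whose erasure ratio exceeds 1 -
-- h_lin. The estimate at time T then takes fewer than Λ^T values, by an exponential factor, while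
-- the initial states that A^T brings within K of a given value have volume O(Λ^(-T))
-- (`LTI.exists_volume_le`). So the initial states with error at most K for ever form a null set.
-- The union over integers K is null as well and cannot fill a ball.

open scoped Matrix

noncomputable section

-- Spectral mapping and almost diagonal triangular form

/-- The determinant of a polynomial in a complex matrix is the product of the values of the
polynomial at the eigenvalues. -/
theorem Matrix.det_aeval_eq_prod_roots_charpoly {ι : Type*} [Fintype ι] [DecidableEq ι]
    (A : Matrix ι ι ℂ) (g : Polynomial ℂ) :
    (Polynomial.aeval A g).det = (A.charpoly.roots.map fun z => g.eval z).prod := by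
  have hsplit := IsAlgClosed.splits A.charpoly
  have hcard : A.charpoly.roots.card = Fintype.card ι := by
    rw [← hsplit.natDegree_eq_card_roots, Matrix.charpoly_natDegree_eq_dim]
  have hlin (a : ℂ) : (A - algebraMap ℂ _ a).det = (A.charpoly.roots.map fun z => z - a).prod := by
    have h1 : A.charpoly.eval a = (A.charpoly.roots.map fun z => a - z).prod := by
      conv_lhs => rw [hsplit.eq_prod_roots_of_monic A.charpoly_monic]
      rw [Polynomial.eval_multiset_prod, Multiset.map_map]
      simp
    have h2 : (A - algebraMap ℂ _ a) = -(Matrix.scalar ι a - A) := by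
      simp [Matrix.algebraMap_eq_diagonal, Matrix.scalar_apply, Pi.algebraMap_def]
    rw [h2, Matrix.det_neg, ← Matrix.eval_charpoly, h1, ← hcard]
    have h3 : (A.charpoly.roots.map fun z => z - a)
        = (A.charpoly.roots.map fun z => -(a - z)) := by simp
    rw [h3]
    induction A.charpoly.roots using Multiset.induction_on with
    | empty => simp
    | cons z s ih =>
      simp only [Multiset.map_cons, Multiset.prod_cons, Multiset.card_cons, pow_succ, ← ih]
      ring
  have hprod (s : Multiset ℂ) :
      (Polynomial.aeval A (s.map fun a => Polynomial.X - Polynomial.C a).prod).det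
        = (A.charpoly.roots.map fun z =>
            ((s.map fun a => Polynomial.X - Polynomial.C a).prod).eval z).prod := by
    induction s using Multiset.induction_on with
    | empty => simp
    | cons a s ih =>
      simp only [Multiset.map_cons, Multiset.prod_cons, map_mul, Matrix.det_mul, ih,
        Polynomial.eval_mul, Multiset.prod_map_mul]
      congr 1
      simpa using hlin a
  have hg := (IsAlgClosed.splits g).eq_prod_roots
  rw [hg]
  simp only [map_mul, Matrix.det_mul, hprod, Polynomial.eval_mul, Multiset.prod_map_mul]
  congr 1
  simp [Matrix.algebraMap_eq_diagonal, hcard]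

/-- The determinant formula for the polynomial a - X^k identifies the characteristic polynomials at
every a, so multiplicities are preserved. -/
theorem Matrix.roots_charpoly_pow {ι : Type*} [Fintype ι] [DecidableEq ι]
    (A : Matrix ι ι ℂ) (k : ℕ) :
    (A ^ k).charpoly.roots = A.charpoly.roots.map fun z => z ^ k := by
  have h : (A ^ k).charpoly
      = ((A.charpoly.roots.map fun z => z ^ k).map
          fun a => Polynomial.X - Polynomial.C a).prod := by
    refine Polynomial.funext fun a => ?_
    have := A.det_aeval_eq_prod_roots_charpoly (Polynomial.C a - Polynomial.X ^ k)
    rw [Matrix.eval_charpoly, Polynomial.eval_multiset_prod]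
    simp only [map_sub, Polynomial.aeval_C, map_pow, Polynomial.aeval_X, Polynomial.eval_sub,
      Polynomial.eval_C, Polynomial.eval_pow, Polynomial.eval_X] at this
    simp only [Multiset.map_map, Function.comp_def, Polynomial.eval_sub, Polynomial.eval_X,
      Polynomial.eval_C, ← this]
    simp [Matrix.algebraMap_eq_diagonal, Matrix.scalar_apply, Pi.algebraMap_def]
  rw [h, Polynomial.roots_multiset_prod_X_sub_C]

/-- An endomorphism of a finite-dimensional complex space is upper triangular, with arbitrarily
small entries off the diagonal, in a suitable basis. -/
theorem Module.End.exists_basis_upperTriangular {ε : ℝ} (hε : 0 < ε) (n : ℕ) :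
    ∀ {V : Type} [AddCommGroup V] [Module ℂ V] [FiniteDimensional ℂ V]
      (_ : Module.finrank ℂ V = n) (f : Module.End ℂ V),
      ∃ b : Module.Basis (Fin n) ℂ V, (∀ i j, j < i → b.repr (f (b j)) i = 0) ∧
        ∀ i j, i ≠ j → ‖b.repr (f (b j)) i‖ ≤ ε := by
  induction n with
  | zero =>
    intro V _ _ _ hn f
    exact ⟨Module.finBasisOfFinrankEq ℂ V hn, fun i => i.elim0, fun i => i.elim0⟩
  | succ n ih =>
    intro V _ _ _ hn f
    have : Nontrivial V := Module.nontrivial_of_finrank_pos (R := ℂ) (by omega)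
    obtain ⟨μ, hμ⟩ := Module.End.exists_eigenvalue f
    have hlt : LinearMap.range (f - algebraMap ℂ (Module.End ℂ V) μ) < ⊤ := by
      rw [lt_top_iff_ne_top]
      intro htop
      have hinj := (LinearMap.injective_iff_surjective).2 (LinearMap.range_eq_top.1 htop)
      obtain ⟨x, hx⟩ := hμ.exists_hasEigenvector
      refine hx.2 (hinj ?_)
      simp [hx.apply_eq_smul, Module.algebraMap_end_apply]
    -- A nonzero functional vanishing on the range of f - μ is a left eigenvector: φ ∘ f = μ φ. Its
    -- kernel is an invariant hyperplane, to which the induction applies; a vector outside it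
    -- becomes the last basis vector.
    obtain ⟨φ, hφ0, hφ⟩ := Submodule.exists_le_ker_of_lt_top _ hlt
    obtain ⟨y, hy⟩ : ∃ y, φ y ≠ 0 := by
      by_contra! h
      exact hφ0 (LinearMap.ext h)
    have hinv : ∀ x, φ (f x) = μ * φ x := by
      intro x
      have : φ ((f - algebraMap ℂ (Module.End ℂ V) μ) x) = 0 := hφ ⟨x, rfl⟩
      simpa [Module.algebraMap_end_apply, sub_eq_zero] using this
    have hmap : ∀ x ∈ LinearMap.ker φ, f x ∈ LinearMap.ker φ := by
      intro x hx
      rw [LinearMap.mem_ker] at hx ⊢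
      simp [hinv, hx]
    have hfin : Module.finrank ℂ (LinearMap.ker φ) = n := by
      have h1 := LinearMap.finrank_range_add_finrank_ker φ
      rw [LinearMap.range_eq_top.2 (LinearMap.surjective hφ0), finrank_top,
        Module.finrank_self, hn] at h1
      omega
    obtain ⟨b, hb0, hbε⟩ := ih hfin (f.restrict hmap)
    have hw : f y - μ • y ∈ LinearMap.ker φ := by simp [hinv]
    -- Scaling the last basis vector by δ scales the off-diagonal part of its column by δ and leaves
    -- the diagonal entry μ unchanged.
    obtain ⟨δ, hδ, hδw⟩ : ∃ δ : ℝ, 0 < δ ∧ ∀ i, δ * ‖b.repr ⟨_, hw⟩ i‖ ≤ ε := by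
      set B := ∑ i, ‖b.repr ⟨_, hw⟩ i‖
      have hB : 0 ≤ B := Finset.sum_nonneg fun _ _ => norm_nonneg _
      refine ⟨ε / (B + 1), by positivity, fun i => ?_⟩
      have hi : ‖b.repr ⟨_, hw⟩ i‖ ≤ B :=
        Finset.single_le_sum (f := fun i => ‖b.repr ⟨_, hw⟩ i‖) (fun _ _ => norm_nonneg _)
          (Finset.mem_univ i)
      rw [div_mul_eq_mul_div, div_le_iff₀ (by positivity)]
      gcongr
      linarith
    have hδ0 : (δ : ℂ) ≠ 0 := by exact_mod_cast hδ.ne'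
    set b' : Module.Basis (Fin (n + 1)) ℂ V := Module.Basis.mkFinSnoc b ((δ : ℂ) • y)
      (by
        intro c x hx hc
        have := congrArg φ hc
        rw [LinearMap.mem_ker] at hx
        simpa [hx, hy, hδ0] using this)
      (by
        intro z
        refine ⟨-(φ z / (δ * φ y)), ?_⟩
        rw [LinearMap.mem_ker]
        simp only [map_add, map_smul, smul_eq_mul]
        field_simp
        ring) with hb'
    have hcast (i : Fin n) : b' i.castSucc = b i := by simp [hb']
    have hlast : b' (Fin.last n) = (δ : ℂ) • y := by simp [hb']
    have hrepr (w : LinearMap.ker φ) :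
        b'.repr w = ∑ i, b.repr w i • Finsupp.single i.castSucc (1 : ℂ) := by
      conv_lhs => rw [← b.sum_repr w]
      simp only [Submodule.coe_sum, Submodule.coe_smul, map_sum, map_smul, ← hcast,
        Module.Basis.repr_self]
    have hrepr_last (w : LinearMap.ker φ) : b'.repr w (Fin.last n) = 0 := by
      simp [hrepr, Finsupp.finsetSum_apply, Fin.castSucc_ne_last]
    have hrepr_cast (w : LinearMap.ker φ) (j : Fin n) :
        b'.repr w j.castSucc = b.repr w j := by
      simp [hrepr, Finsupp.finsetSum_apply, Finsupp.single_apply]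
    have hfcast (i : Fin n) : f (b' i.castSucc) = (f.restrict hmap (b i) : LinearMap.ker φ) := by
      simp [hcast]
    have hflast : f (b' (Fin.last n)) = μ • b' (Fin.last n)
        + (δ : ℂ) • ((⟨_, hw⟩ : LinearMap.ker φ) : V) := by
      rw [hlast]
      simp only [map_smul]
      module
    refine ⟨b', fun i j hij => ?_, fun i j hij => ?_⟩
    · induction j using Fin.lastCases with
      | last => exact absurd hij (Fin.le_last i).not_gt
      | cast j =>
        rw [hfcast]
        induction i using Fin.lastCases with
        | last => exact hrepr_last _
        | cast i => rw [hrepr_cast]; exact hb0 i j (by simpa using hij)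
    · induction j using Fin.lastCases with
      | last =>
        rw [hflast]
        induction i using Fin.lastCases with
        | last => exact absurd rfl hij
        | cast i =>
          have h1 := hrepr_cast ⟨_, hw⟩ i
          rw [map_add, map_smul, map_smul, Finsupp.add_apply, Finsupp.smul_apply,
            Finsupp.smul_apply, h1, Module.Basis.repr_self, Finsupp.single_eq_of_ne hij]
          simpa [abs_of_pos hδ] using hδw i
      | cast j =>
        rw [hfcast]
        induction i using Fin.lastCases with
        | last => rw [hrepr_last]; simpa using hε.le
        | cast i => rw [hrepr_cast]; exact hbε i j (by simpa using hij)

-- Unstable eigenvalues and covering numbers of matrix powers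

namespace LTI

variable {n : ℕ}

/-- The product of the moduli of the eigenvalues outside the open unit disc. -/
def unstableProduct (A : Matrix (Fin n) (Fin n) ℝ) : ℝ :=
  ((eigenvalues A).map fun z => max 1 ‖z‖).prod

theorem one_le_unstableProduct (A : Matrix (Fin n) (Fin n) ℝ) : 1 ≤ unstableProduct A := by
  unfold unstableProduct
  induction eigenvalues A using Multiset.induction_on with
  | empty => simp
  | cons a s ih =>
    rw [Multiset.map_cons, Multiset.prod_cons]
    exact one_le_mul_of_one_le_of_one_le (le_max_left _ _) ih

theorem topologicalEntropy_eq_logb_unstableProduct (A : Matrix (Fin n) (Fin n) ℝ) (q : ℕ) :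
    topologicalEntropy A q = Real.logb q (unstableProduct A) := by
  unfold topologicalEntropy unstableProduct
  have hpos (s : Multiset ℂ) : 0 < (s.map fun z => max 1 ‖z‖).prod := by
    induction s using Multiset.induction_on with
    | empty => simp
    | cons a s ih => rw [Multiset.map_cons, Multiset.prod_cons]; positivity
  induction eigenvalues A using Multiset.induction_on with
  | empty => simp
  | cons a s ih =>
    rw [Multiset.map_cons, Multiset.prod_cons, Real.logb_mul (by positivity) (hpos s).ne', ← ih]
    by_cases h : 1 ≤ ‖a‖
    · rw [Multiset.filter_cons_of_pos (p := fun z : ℂ => 1 ≤ ‖z‖) _ h, Multiset.map_cons,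
        Multiset.sum_cons, max_eq_right h]
    · rw [Multiset.filter_cons_of_neg (p := fun z : ℂ => 1 ≤ ‖z‖) _ h, max_eq_left (not_le.1 h).le]
      simp

end LTI

/-- A linear map of `ℂ ^ n` whose off-diagonal row sums are at most `1` maps the unit polydisc into
the union of few translates of it. -/
theorem Matrix.exists_finset_cover_mulVec {n : ℕ} (M : Matrix (Fin n) (Fin n) ℂ)
    (hM : ∀ i, ∑ j ∈ Finset.univ.erase i, ‖M i j‖ ≤ 1) :
    ∃ F : Finset (Fin n → ℂ), (F.card : ℝ) ≤ ∏ i, (2 * ‖M i i‖ + 4) ^ 2 ∧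
      ∀ u : Fin n → ℂ, ‖u‖ ≤ 1 → ∃ c ∈ F, ‖M *ᵥ u - c‖ ≤ 1 := by
  classical
  let κ (i : Fin n) : ℤ := ⌊‖M i i‖ + 1 + 1 / 2⌋
  have hκ (i : Fin n) : 0 ≤ κ i := Int.floor_nonneg.2 (by positivity)
  -- The centres have Gaussian integers as coordinates: rounding the real and the imaginary part
  -- moves a coordinate by at most 1/2 + 1/2 = 1.
  let I (i : Fin n) : Finset ℂ := (Finset.Icc (-κ i) (κ i) ×ˢ Finset.Icc (-κ i) (κ i)).image
    fun a => (⟨(a.1 : ℝ), (a.2 : ℝ)⟩ : ℂ)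
  have hround (i : Fin n) (x : ℝ) (hx : |x| ≤ ‖M i i‖ + 1) : round x ∈ Finset.Icc (-κ i) (κ i) := by
    have h1 := abs_sub_round x
    have h2 : |(round x : ℝ)| ≤ ‖M i i‖ + 1 + 1 / 2 := by
      have := abs_sub_abs_le_abs_sub (round x : ℝ) x
      rw [abs_sub_comm] at this
      linarith
    have h3 : |round x| ≤ κ i := Int.le_floor.2 (by push_cast; exact h2)
    exact Finset.mem_Icc.2 (abs_le.1 h3)
  have hI (i : Fin n) : ((I i).card : ℝ) ≤ (2 * ‖M i i‖ + 4) ^ 2 := by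
    have h1 : ((Finset.Icc (-κ i) (κ i)).card : ℝ) ≤ 2 * ‖M i i‖ + 4 := by
      rw [Int.card_Icc]
      have h2 : ((κ i + 1 - -κ i).toNat : ℤ) = 2 * κ i + 1 := by
        rw [Int.toNat_of_nonneg (by linarith [hκ i])]; ring
      have h3 : (((κ i + 1 - -κ i).toNat : ℕ) : ℝ) = 2 * (κ i : ℝ) + 1 := by exact_mod_cast h2
      have h4 : (κ i : ℝ) ≤ ‖M i i‖ + 1 + 1 / 2 := Int.floor_le _
      rw [h3]; linarith
    calc ((I i).card : ℝ)
        ≤ ((Finset.Icc (-κ i) (κ i) ×ˢ Finset.Icc (-κ i) (κ i)).card : ℝ) := by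
          exact_mod_cast Finset.card_image_le
      _ = ((Finset.Icc (-κ i) (κ i)).card : ℝ) ^ 2 := by rw [Finset.card_product]; push_cast; ring
      _ ≤ _ := by gcongr
  refine ⟨Fintype.piFinset I, ?_, fun u hu => ?_⟩
  · rw [Fintype.card_piFinset]
    push_cast
    exact Finset.prod_le_prod (fun _ _ => by positivity) fun i _ => hI i
  · have hnorm (i : Fin n) : ‖(M *ᵥ u) i‖ ≤ ‖M i i‖ + 1 := by
      have hu' (j : Fin n) : ‖u j‖ ≤ 1 := (norm_le_pi_norm u j).trans hu
      calc ‖(M *ᵥ u) i‖ ≤ ∑ j, ‖M i j * u j‖ :=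
            norm_sum_le Finset.univ fun j => M i j * u j
        _ ≤ ∑ j, ‖M i j‖ := Finset.sum_le_sum fun j _ => by
            rw [norm_mul]; exact mul_le_of_le_one_right (norm_nonneg _) (hu' j)
        _ = ‖M i i‖ + ∑ j ∈ Finset.univ.erase i, ‖M i j‖ :=
            (Finset.add_sum_erase _ _ (Finset.mem_univ i)).symm
        _ ≤ _ := by linarith [hM i]
    refine ⟨fun i => ⟨(round ((M *ᵥ u) i).re : ℝ), (round ((M *ᵥ u) i).im : ℝ)⟩, ?_, ?_⟩
    · rw [Fintype.mem_piFinset]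
      intro i
      refine Finset.mem_image.2 ⟨(round ((M *ᵥ u) i).re, round ((M *ᵥ u) i).im), ?_, rfl⟩
      exact Finset.mem_product.2 ⟨hround i _ ((Complex.abs_re_le_norm _).trans (hnorm i)),
        hround i _ ((Complex.abs_im_le_norm _).trans (hnorm i))⟩
    · rw [pi_norm_le_iff_of_nonneg zero_le_one]
      intro i
      refine (Complex.norm_le_abs_re_add_abs_im _).trans ?_
      have h1 := abs_sub_round ((M *ᵥ u) i).re
      have h2 := abs_sub_round ((M *ᵥ u) i).im
      simp only [Pi.sub_apply, Complex.sub_re, Complex.sub_im]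
      linarith

/-- Covers compose: if M^k u - c lies in the unit polydisc, then M (M^k u - c) is within 1 of some d
in `F`, so M^(k+1) u is within 1 of M c + d. -/
theorem Matrix.exists_finset_cover_pow_mulVec {n : ℕ} {M : Matrix (Fin n) (Fin n) ℂ} {N : ℝ}
    {F : Finset (Fin n → ℂ)} (hN : (F.card : ℝ) ≤ N)
    (hF : ∀ u : Fin n → ℂ, ‖u‖ ≤ 1 → ∃ c ∈ F, ‖M *ᵥ u - c‖ ≤ 1) (k : ℕ) :
    ∃ G : Finset (Fin n → ℂ), (G.card : ℝ) ≤ N ^ k ∧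
      ∀ u : Fin n → ℂ, ‖u‖ ≤ 1 → ∃ c ∈ G, ‖(M ^ k) *ᵥ u - c‖ ≤ 1 := by
  classical
  have hN0 : 0 ≤ N := le_trans (by positivity) hN
  induction k with
  | zero => exact ⟨{0}, by simp, fun u hu => ⟨0, by simp, by simpa using hu⟩⟩
  | succ k ih =>
    obtain ⟨G, hG, hGu⟩ := ih
    refine ⟨(G ×ˢ F).image fun a => M *ᵥ a.1 + a.2, ?_, fun u hu => ?_⟩
    · calc (((G ×ˢ F).image fun a => M *ᵥ a.1 + a.2).card : ℝ) ≤ ((G ×ˢ F).card : ℝ) := by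
            exact_mod_cast Finset.card_image_le
        _ = G.card * F.card := by rw [Finset.card_product]; push_cast; rfl
        _ ≤ N ^ k * N := by gcongr
        _ = N ^ (k + 1) := (pow_succ _ _).symm
    · obtain ⟨c, hc, hcu⟩ := hGu u hu
      obtain ⟨d, hd, hdu⟩ := hF _ hcu
      refine ⟨M *ᵥ c + d, Finset.mem_image.2 ⟨(c, d), by simp [hc, hd], rfl⟩, ?_⟩
      rw [pow_succ', ← Matrix.mulVec_mulVec]
      rw [Matrix.mulVec_sub] at hdu
      rwa [← sub_sub]

theorem Matrix.exists_norm_mulVec_le {m n : Type*} [Fintype m] [Fintype n]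
    {𝕜 : Type*} [RCLike 𝕜] (M : Matrix m n 𝕜) : ∃ c : ℝ, 0 < c ∧ ∀ x, ‖M *ᵥ x‖ ≤ c * ‖x‖ := by
  obtain ⟨c, hc, h⟩ := (LinearMap.toContinuousLinearMap (Matrix.mulVecLin M)).bound
  exact ⟨c, hc, h⟩

/-- The vector with real part `x` and imaginary part `y`. -/
def complexVector {n : ℕ} (x y : Fin n → ℝ) : Fin n → ℂ := fun i => ⟨x i, y i⟩

theorem map_mulVec_complexVector {n : ℕ} (A : Matrix (Fin n) (Fin n) ℝ) (x y : Fin n → ℝ) :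
    A.map (algebraMap ℝ ℂ) *ᵥ complexVector x y = complexVector (A *ᵥ x) (A *ᵥ y) := by
  ext i
  simp only [Matrix.mulVec, dotProduct, complexVector, Matrix.map_apply]
  apply Complex.ext <;> simp

theorem norm_complexVector_le {n : ℕ} {x y : Fin n → ℝ} {r : ℝ} (hx : ‖x‖ ≤ r) (hy : ‖y‖ ≤ r) :
    ‖complexVector x y‖ ≤ 2 * r := by
  rw [pi_norm_le_iff_of_nonneg (by linarith [norm_nonneg x])]
  intro i
  refine (Complex.norm_le_abs_re_add_abs_im _).trans ?_
  have h1 : |x i| ≤ r := (norm_le_pi_norm x i).trans hx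
  have h2 : |y i| ≤ r := (norm_le_pi_norm y i).trans hy
  simp only [complexVector]
  linarith

theorem norm_re_le_norm_complexVector {n : ℕ} (x y : Fin n → ℝ) : ‖x‖ ≤ ‖complexVector x y‖ := by
  rw [pi_norm_le_iff_of_nonneg (norm_nonneg _)]
  exact fun i => (Complex.abs_re_le_norm (complexVector x y i)).trans (norm_le_pi_norm _ i)

theorem norm_im_le_norm_complexVector {n : ℕ} (x y : Fin n → ℝ) : ‖y‖ ≤ ‖complexVector x y‖ := by
  rw [pi_norm_le_iff_of_nonneg (norm_nonneg _)]
  exact fun i => (Complex.abs_im_le_norm (complexVector x y i)).trans (norm_le_pi_norm _ i)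

theorem complexVector_sub {n : ℕ} (x y x' y' : Fin n → ℝ) :
    complexVector x y - complexVector x' y' = complexVector (x - x') (y - y') := by
  ext i
  apply Complex.ext <;> simp [complexVector]

/-- The image of the unit polydisc of `ℂ ^ n` under the powers of `A ^ k` is covered by polydiscs of
radius `r`, in a number that grows essentially like the squared product of the moduli of the
unstable eigenvalues of `A ^ k`. -/
theorem LTI.exists_finset_cover_complex {n : ℕ} (A : Matrix (Fin n) (Fin n) ℝ) (k : ℕ) {r : ℝ}
    (hr : 0 < r) :
    ∃ L : ℝ, 0 < L ∧ ∀ j : ℕ, ∃ G : Finset (Fin n → ℂ),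
      (G.card : ℝ) ≤ L * ((6 ^ n * unstableProduct A ^ k) ^ j) ^ 2 ∧
      ∀ z : Fin n → ℂ, ‖z‖ ≤ 2 →
        ∃ c ∈ G, ‖((A.map (algebraMap ℝ ℂ)) ^ (k * j)) *ᵥ z - c‖ ≤ r := by
  classical
  set B := (A.map (algebraMap ℝ ℂ)) ^ k with hB
  -- The tolerance 1/(n+1) keeps each off-diagonal row sum at most 1.
  obtain ⟨b, hb0, hbε⟩ := Module.End.exists_basis_upperTriangular
    (ε := 1 / (n + 1)) (by positivity) n (V := Fin n → ℂ) (by simp) (Matrix.toLin' B)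
  set M : Matrix (Fin n) (Fin n) ℂ := LinearMap.toMatrix b b (Matrix.toLin' B) with hM
  have hMij (i j : Fin n) : M i j = b.repr (Matrix.toLin' B (b j)) i := by
    rw [hM, LinearMap.toMatrix_apply]
  have hMtri : M.IsUpperTriangular := fun i j hij => by rw [hMij]; exact hb0 i j hij
  have hchar : M.charpoly = B.charpoly := by
    rw [hM, LinearMap.charpoly_toMatrix, Matrix.charpoly_toLin']
  have hdiag : Finset.univ.val.map (fun i => M i i)
      = (eigenvalues A).map fun z => z ^ k := by
    rw [eigenvalues, ← Matrix.roots_charpoly_pow, ← hB, ← hchar,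
      Matrix.charpoly_of_isUpperTriangular M hMtri]
    have h := Polynomial.roots_multiset_prod_X_sub_C (Finset.univ.val.map fun i => M i i)
    rw [Multiset.map_map] at h
    exact h.symm
  have hrow (i : Fin n) : ∑ j ∈ Finset.univ.erase i, ‖M i j‖ ≤ 1 := by
    calc ∑ j ∈ Finset.univ.erase i, ‖M i j‖
        ≤ ∑ j ∈ Finset.univ.erase i, (1 / (n + 1) : ℝ) := by
          refine Finset.sum_le_sum fun j hj => ?_
          rw [hMij]
          exact hbε i j (Finset.ne_of_mem_erase hj).symm
      _ ≤ ∑ j : Fin n, (1 / (n + 1) : ℝ) :=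
          Finset.sum_le_sum_of_subset_of_nonneg (Finset.erase_subset _ _)
            fun _ _ _ => by positivity
      _ = n / (n + 1) := by simp; ring
      _ ≤ 1 := by rw [div_le_one (by positivity)]; linarith
  obtain ⟨F, hF, hFu⟩ := M.exists_finset_cover_mulVec hrow
  -- The factor 6 comes from 2a + 4 ≤ 6 max(1, a).
  have hprod : ∏ i, (2 * ‖M i i‖ + 4) ^ 2 ≤ (6 ^ n * unstableProduct A ^ k) ^ 2 := by
    have h1 : unstableProduct A ^ k = ∏ i, max 1 ‖M i i‖ := by
      have h2 : (Finset.univ.val.map (fun i => M i i)).map (fun z => max 1 ‖z‖)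
          = (eigenvalues A).map fun z => (max 1 ‖z‖) ^ k := by
        rw [hdiag, Multiset.map_map]
        refine Multiset.map_congr rfl fun z _ => ?_
        simp only [Function.comp_apply, norm_pow]
        rcases le_total 1 ‖z‖ with h | h
        · rw [max_eq_right h, max_eq_right (one_le_pow₀ h)]
        · rw [max_eq_left h, max_eq_left (pow_le_one₀ (norm_nonneg _) h), one_pow]
      rw [unstableProduct, ← Multiset.prod_map_pow, ← h2, Multiset.map_map]
      rfl
    rw [Finset.prod_pow, h1]
    gcongr
    calc ∏ i, (2 * ‖M i i‖ + 4) ≤ ∏ i, 6 * max 1 ‖M i i‖ := by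
          refine Finset.prod_le_prod (fun _ _ => by positivity) fun i _ => ?_
          linarith [le_max_left 1 ‖M i i‖, le_max_right 1 ‖M i i‖]
      _ = _ := by rw [Finset.prod_mul_distrib]; simp
  have hcoord (z : Fin n → ℂ) (j : ℕ) :
      b.equivFun ((B ^ j) *ᵥ z) = (M ^ j) *ᵥ b.equivFun z := by
    have h1 : M ^ j = LinearMap.toMatrix b b (Matrix.toLin' (B ^ j)) := by
      rw [hM, LinearMap.toMatrix_pow, ← Matrix.toLin'_pow]
    rw [h1]
    exact (LinearMap.toMatrix_mulVec_repr b b (Matrix.toLin' (B ^ j)) z).symm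
  obtain ⟨K, hK, hKz⟩ := (LinearMap.toContinuousLinearMap
    (b.equivFun : (Fin n → ℂ) →ₗ[ℂ] (Fin n → ℂ))).bound
  obtain ⟨K', hK', hKz'⟩ := (LinearMap.toContinuousLinearMap
    (b.equivFun.symm : (Fin n → ℂ) →ₗ[ℂ] (Fin n → ℂ))).bound
  set s : ℝ := r / K' with hs
  have hs0 : 0 < s := by positivity
  -- In the coordinates of b, the initial set is cut once into finitely many balls of radius s = r /
  -- K'; their number enters the constant L, which is thus independent of j.
  obtain ⟨t, -, htfin, ht⟩ := (isCompact_closedBall (0 : Fin n → ℂ) (K * 2)).finite_cover_balls hs0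
  refine ⟨htfin.toFinset.card + 1, by positivity, fun j => ?_⟩
  obtain ⟨G, hG, hGu⟩ := Matrix.exists_finset_cover_pow_mulVec (hF.trans hprod) hFu j
  refine ⟨(htfin.toFinset ×ˢ G).image fun a =>
    b.equivFun.symm ((M ^ j) *ᵥ a.1 + (s : ℂ) • a.2), ?_, fun z hz => ?_⟩
  · calc _ ≤ ((htfin.toFinset ×ˢ G).card : ℝ) := by exact_mod_cast Finset.card_image_le
      _ = htfin.toFinset.card * G.card := by rw [Finset.card_product]; push_cast; rfl
      _ ≤ (htfin.toFinset.card + 1) * ((6 ^ n * unstableProduct A ^ k) ^ 2) ^ j := by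
          gcongr; linarith
      _ = _ := by rw [← pow_mul, ← pow_mul, mul_comm 2 j]
  · have h1 : b.equivFun z ∈ Metric.closedBall (0 : Fin n → ℂ) (K * 2) := by
      rw [mem_closedBall_zero_iff]
      exact (hKz z).trans (by gcongr)
    obtain ⟨c, hc, hzc⟩ := Set.mem_iUnion₂.1 (ht h1)
    rw [Metric.mem_ball, dist_eq_norm] at hzc
    set e : Fin n → ℂ := (s : ℂ)⁻¹ • (b.equivFun z - c) with he
    have hs' : (s : ℂ) ≠ 0 := by exact_mod_cast hs0.ne'
    have he1 : ‖e‖ ≤ 1 := by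
      rw [he, norm_smul, norm_inv, Complex.norm_real, Real.norm_of_nonneg hs0.le,
        inv_mul_le_iff₀ hs0]
      linarith
    obtain ⟨d, hd, hed⟩ := hGu e he1
    refine ⟨_, Finset.mem_image.2 ⟨(c, d), by simpa using ⟨hc, hd⟩, rfl⟩, ?_⟩
    have h2 : b.equivFun z = c + (s : ℂ) • e := by
      rw [he, smul_smul, mul_inv_cancel₀ hs', one_smul]; abel
    have h3 : ((A.map (algebraMap ℝ ℂ)) ^ (k * j)) *ᵥ z
        - b.equivFun.symm ((M ^ j) *ᵥ c + (s : ℂ) • d)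
        = b.equivFun.symm ((s : ℂ) • ((M ^ j) *ᵥ e - d)) := by
      apply b.equivFun.injective
      rw [map_sub, LinearEquiv.apply_symm_apply, LinearEquiv.apply_symm_apply, pow_mul, ← hB,
        hcoord, h2, Matrix.mulVec_add, Matrix.mulVec_smul, smul_sub]
      abel
    rw [h3]
    refine (hKz' _).trans ?_
    rw [norm_smul, Complex.norm_real, Real.norm_of_nonneg hs0.le]
    calc K' * (s * ‖(M ^ j) *ᵥ e - d‖) ≤ K' * (s * 1) := by gcongr
      _ = r := by rw [hs]; field_simp

/-- The images of the unit ball under arbitrarily high powers of `A` are covered by balls of radius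
`1 / 2`, in a number that grows essentially like the product of the moduli of the unstable
eigenvalues. -/
theorem LTI.exists_finset_cover_pow {n : ℕ} (A : Matrix (Fin n) (Fin n) ℝ) {R : ℝ}
    (hR : unstableProduct A < R) :
    ∃ k : ℕ, 0 < k ∧ ∃ L : ℝ, 0 < L ∧ ∀ j : ℕ, ∃ F : Finset (Fin n → ℝ),
      (F.card : ℝ) ≤ L * R ^ (k * j) ∧
      ∀ x : Fin n → ℝ, ‖x‖ ≤ 1 → ∃ c ∈ F, ‖(A ^ (k * j)) *ᵥ x - c‖ ≤ 1 / 2 := by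
  classical
  have hΛ := one_le_unstableProduct A
  -- For large k the loss 6^n per step of length k is absorbed by (R / Λ)^k.
  obtain ⟨k, hk, hkR⟩ : ∃ k : ℕ, 0 < k ∧ 6 ^ n * unstableProduct A ^ k ≤ R ^ k := by
    obtain ⟨k, hk⟩ := pow_unbounded_of_one_lt ((6 : ℝ) ^ n)
      ((one_lt_div (by linarith)).2 hR : 1 < R / unstableProduct A)
    have hkpos : k ≠ 0 := by
      rintro rfl
      have : (1 : ℝ) ≤ 6 ^ n := one_le_pow₀ (by norm_num)
      simp at hk; linarith
    refine ⟨k, Nat.pos_of_ne_zero hkpos, ?_⟩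
    rw [div_pow, lt_div_iff₀ (by positivity)] at hk
    exact hk.le
  obtain ⟨L, hL, hcov⟩ := exists_finset_cover_complex A k (r := 1 / 8) (by norm_num)
  refine ⟨k, hk, √L, by positivity, fun j => ?_⟩
  obtain ⟨G, hG, hGz⟩ := hcov j
  have hbound : √L * (6 ^ n * unstableProduct A ^ k) ^ j ≤ √L * R ^ (k * j) := by
    rw [pow_mul R]; gcongr
  -- Subsets of the unit ball whose images are 1/2-separated; the images of a maximal one form the
  -- required net.
  let P (F : Finset (Fin n → ℝ)) : Prop :=
    (∀ x ∈ F, ‖x‖ ≤ 1) ∧ ∀ x ∈ F, ∀ y ∈ F, x ≠ y → 1 / 2 < ‖(A ^ (k * j)) *ᵥ x - (A ^ (k * j)) *ᵥ y‖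
  have hP (F : Finset (Fin n → ℝ)) (hF : P F) :
      (F.card : ℝ) ≤ √L * (6 ^ n * unstableProduct A ^ k) ^ j := by
    -- A pair of real points is one complex vector, and different pairs need different centres
    -- because 1/8 + 1/8 < 1/2. Hence |F|^2 ≤ |G|, and the root undoes the square in the complex
    -- count.
    have hex (a : (Fin n → ℝ) × (Fin n → ℝ)) : ∃ c, a ∈ F ×ˢ F → c ∈ G ∧
        ‖complexVector ((A ^ (k * j)) *ᵥ a.1) ((A ^ (k * j)) *ᵥ a.2) - c‖ ≤ 1 / 8 := by
      by_cases ha : a ∈ F ×ˢ F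
      · rw [Finset.mem_product] at ha
        obtain ⟨c, hc, hc'⟩ := hGz (complexVector a.1 a.2)
          ((norm_complexVector_le (hF.1 _ ha.1) (hF.1 _ ha.2)).trans (by norm_num))
        refine ⟨c, fun _ => ⟨hc, ?_⟩⟩
        rw [← map_mulVec_complexVector]
        convert hc' using 4
        exact Matrix.map_pow _ _ _
      · exact ⟨0, fun h => absurd h ha⟩
    choose γ hγ using hex
    have hcard : (F ×ˢ F).card ≤ G.card := by
      refine Finset.card_le_card_of_injOn γ (fun a ha => (hγ a ha).1) ?_
      intro a ha a' ha' haa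
      have h1 := (hγ a ha).2
      have h2 := (hγ a' ha').2
      rw [haa] at h1
      have h3 := norm_sub_le_norm_sub_add_norm_sub
        (complexVector ((A ^ (k * j)) *ᵥ a.1) ((A ^ (k * j)) *ᵥ a.2)) (γ a')
        (complexVector ((A ^ (k * j)) *ᵥ a'.1) ((A ^ (k * j)) *ᵥ a'.2))
      rw [norm_sub_rev (γ a'), complexVector_sub] at h3
      have h4 := norm_re_le_norm_complexVector
        ((A ^ (k * j)) *ᵥ a.1 - (A ^ (k * j)) *ᵥ a'.1)
        ((A ^ (k * j)) *ᵥ a.2 - (A ^ (k * j)) *ᵥ a'.2)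
      have h5 := norm_im_le_norm_complexVector
        ((A ^ (k * j)) *ᵥ a.1 - (A ^ (k * j)) *ᵥ a'.1)
        ((A ^ (k * j)) *ᵥ a.2 - (A ^ (k * j)) *ᵥ a'.2)
      have hm := Finset.mem_product.1 ha
      have hm' := Finset.mem_product.1 ha'
      refine Prod.ext ?_ ?_
      · by_contra hne
        linarith [hF.2 _ hm.1 _ hm'.1 hne]
      · by_contra hne
        linarith [hF.2 _ hm.2 _ hm'.2 hne]
    rw [Finset.card_product] at hcard
    have h1 : ((F.card : ℝ)) ^ 2 ≤ L * ((6 ^ n * unstableProduct A ^ k) ^ j) ^ 2 := by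
      refine le_trans ?_ hG
      rw [sq]
      exact_mod_cast hcard
    refine abs_le_of_sq_le_sq' ?_ (by positivity) |>.2
    rwa [mul_pow, Real.sq_sqrt hL.le]
  have hne : ∃ F, P F := ⟨∅, by simp [P]⟩
  obtain ⟨F, hF, hmax⟩ : ∃ F, P F ∧ ∀ F', P F' → F'.card ≤ F.card := by
    have hbdd : BddAbove {m | ∃ F, P F ∧ F.card = m} := by
      refine ⟨⌊√L * (6 ^ n * unstableProduct A ^ k) ^ j⌋₊, ?_⟩
      rintro m ⟨F, hF, rfl⟩
      exact Nat.le_floor (hP F hF)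
    obtain ⟨F, hF, hFm⟩ := Nat.sSup_mem (s := {m | ∃ F, P F ∧ F.card = m})
      ⟨_, hne.choose, hne.choose_spec, rfl⟩ hbdd
    exact ⟨F, hF, fun F' hF' => hFm ▸ le_csSup hbdd ⟨F', hF', rfl⟩⟩
  refine ⟨F.image fun x => (A ^ (k * j)) *ᵥ x, ?_, fun x hx => ?_⟩
  · calc _ ≤ (F.card : ℝ) := by exact_mod_cast Finset.card_image_le
      _ ≤ _ := (hP F hF).trans hbound
  · by_contra! hcon
    have hx' : ∀ y ∈ F, 1 / 2 < ‖(A ^ (k * j)) *ᵥ x - (A ^ (k * j)) *ᵥ y‖ := fun y hy =>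
      hcon _ (Finset.mem_image_of_mem _ hy)
    have hxF : x ∉ F := fun h => by
      have := hx' x h
      simp at this
      linarith
    have hins : P (insert x F) := by
      refine ⟨fun y hy => ?_, fun y hy y' hy' hne => ?_⟩
      · rcases Finset.mem_insert.1 hy with rfl | hy
        exacts [hx, hF.1 y hy]
      · rcases Finset.mem_insert.1 hy with hyx | hy <;>
          rcases Finset.mem_insert.1 hy' with hyx' | hy'
        · exact absurd (hyx.trans hyx'.symm) hne
        · rw [hyx]; exact hx' _ hy'
        · rw [hyx', norm_sub_rev]; exact hx' _ hy
        · exact hF.2 _ hy _ hy' hne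
    have := hmax _ hins
    rw [Finset.card_insert_of_notMem hxF] at this
    omega

-- Erasures along walks and the number of noise words

namespace FiniteStateErasureChannel

variable {S : Type*} (ch : FiniteStateErasureChannel S)

theorem cycleRatio_nonneg {k : ℕ} (p : Fin (k + 1) → S) : 0 ≤ ch.cycleRatio p := by
  unfold cycleRatio; positivity

theorem cycleRatio_le_one {k : ℕ} (p : Fin (k + 1) → S) : ch.cycleRatio p ≤ 1 := by
  unfold cycleRatio
  rw [div_le_one (by positivity)]
  exact_mod_cast (Finset.card_le_univ _).trans (by simp)

theorem cycleRatio_le_maximalRatio {k : ℕ} {p : Fin (k + 1) → S} (hp : ch.IsCycle p) :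
    ch.cycleRatio p ≤ ch.maximalRatio := by
  refine le_csSup ⟨1, ?_⟩ ⟨k, p, hp, rfl⟩
  rintro r ⟨k, p, -, rfl⟩
  exact ch.cycleRatio_le_one p

theorem maximalRatio_nonneg : 0 ≤ ch.maximalRatio := by
  refine Real.sSup_nonneg ?_
  rintro r ⟨k, p, -, rfl⟩
  exact ch.cycleRatio_nonneg p

/-- The number of erasures along the first `T` edges of a walk. -/
def erasures (s : ℕ → S) (T : ℕ) : ℕ :=
  ∑ t ∈ Finset.range T, if ch.noise (s t) (s (t + 1)) = true then 1 else 0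

/-- A walk with at least as many edges as there are states contains a cycle. -/
theorem exists_isCycle_of_walk [Fintype S] {s : ℕ → S} {T : ℕ}
    (hs : ∀ t < T, ch.edge (s t) (s (t + 1))) (hT : Fintype.card S ≤ T) :
    ∃ i k : ℕ, i + (k + 1) ≤ T ∧ s i = s (i + (k + 1)) ∧
      ∃ p : Fin (k + 1) → S, ch.IsCycle p ∧ (∀ a, p a = s (i + a)) ∧
        ∀ a, p (a + 1) = s (i + a + 1) := by
  classical
  -- The pigeonhole principle gives a return. A return of least length, over all starting times,
  -- visits distinct states and so is a cycle.
  have hex : ∃ d, 0 < d ∧ ∃ i, i + d ≤ T ∧ s i = s (i + d) := by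
    obtain ⟨a, b, hab, heq⟩ := Fintype.exists_ne_map_eq_of_card_lt
      (fun a : Fin (T + 1) => s a) (by simpa using Nat.lt_succ_of_le hT)
    have hab' : (a : ℕ) ≠ b := fun h => hab (Fin.ext h)
    rcases lt_or_gt_of_ne hab' with h | h
    · exact ⟨b - a, by omega, a, by omega, by rw [Nat.add_sub_cancel' h.le]; exact heq⟩
    · exact ⟨a - b, by omega, b, by omega, by rw [Nat.add_sub_cancel' h.le]; exact heq.symm⟩
  obtain ⟨hd, i, hiT, hi⟩ := Nat.find_spec hex
  have hmin := fun d hd => Nat.find_min hex (m := d) hd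
  obtain ⟨k, hk⟩ : ∃ k, Nat.find hex = k + 1 := ⟨Nat.find hex - 1, by omega⟩
  rw [hk] at hiT hi hmin
  have hnext (a : Fin (k + 1)) : s (i + ((a + 1 : Fin (k + 1)) : ℕ)) = s (i + a + 1) := by
    rcases eq_or_ne a (Fin.last k) with rfl | h
    · simpa [add_assoc] using hi
    · rw [Fin.val_add_one, if_neg h, add_assoc]
  refine ⟨i, k, hiT, hi, fun a => s (i + a), ⟨?_, fun a => ?_⟩, fun a => rfl, hnext⟩
  · intro a b hab
    by_contra hne
    have hne' : (a : ℕ) ≠ b := fun h => hne (Fin.ext h)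
    have ha := a.isLt
    have hb := b.isLt
    dsimp only at hab
    rcases lt_or_gt_of_ne hne' with h | h
    · refine hmin (b - a) (by omega) ⟨by omega, i + a, by omega, ?_⟩
      rw [hab]; congr 1; omega
    · refine hmin (a - b) (by omega) ⟨by omega, i + b, by omega, ?_⟩
      rw [← hab]; congr 1; omega
  · have ha := a.isLt
    simp only [hnext]
    exact hs (i + a) (by omega)

/-- Cutting a cycle of k + 1 edges out of the walk removes at most τ(k + 1) erasures and leaves a
walk. After repeated cuts fewer than |S| edges remain, which accounts for the additive constant. -/
theorem erasures_le [Fintype S] (T : ℕ) :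
    ∀ {s : ℕ → S}, (∀ t < T, ch.edge (s t) (s (t + 1))) →
      (ch.erasures s T : ℝ) ≤ ch.maximalRatio * T + Fintype.card S := by
  induction T using Nat.strong_induction_on with
  | _ T ih =>
    intro s hs
    have hτ := ch.maximalRatio_nonneg
    rcases lt_or_ge T (Fintype.card S) with hT | hT
    · have h1 : ch.erasures s T ≤ T := by
        refine (Finset.sum_le_card_nsmul _ _ 1 fun t _ => ?_).trans (by simp)
        split_ifs <;> simp
      have h2 : (ch.erasures s T : ℝ) ≤ Fintype.card S := by exact_mod_cast h1.trans hT.le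
      have h3 : 0 ≤ ch.maximalRatio * T := by positivity
      linarith
    · obtain ⟨i, k, hik, hi, p, hp, hps, hps'⟩ := ch.exists_isCycle_of_walk hs hT
      obtain ⟨r, rfl⟩ : ∃ r, T = i + (k + 1) + r := ⟨T - (i + (k + 1)), by omega⟩
      set s' : ℕ → S := fun t => if t ≤ i then s t else s (t + (k + 1)) with hs'
      have h1 (t : ℕ) (ht : t ≤ i) : s' t = s t := if_pos ht
      have h2 (t : ℕ) : s' (i + t) = s (i + (k + 1) + t) := by
        rcases Nat.eq_zero_or_pos t with rfl | ht
        · simpa [hs'] using hi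
        · simp only [hs']
          rw [if_neg (by omega)]
          congr 1; omega
      have hwalk : ∀ t < i + r, ch.edge (s' t) (s' (t + 1)) := by
        intro t ht
        rcases lt_or_ge t i with h | h
        · rw [h1 t h.le, h1 (t + 1) h]
          exact hs t (by omega)
        · obtain ⟨u, rfl⟩ := Nat.exists_eq_add_of_le h
          rw [h2, add_assoc i u 1, h2]
          exact hs (i + (k + 1) + u) (by omega)
      have hcycle : (∑ t ∈ Finset.range (k + 1),
          if ch.noise (s (i + t)) (s (i + t + 1)) = true then 1 else 0 : ℕ)
          = (Finset.univ.filter fun a => ch.noise (p a) (p (a + 1)) = true).card := by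
        rw [Finset.card_filter, Finset.sum_range]
        exact Finset.sum_congr rfl fun a _ => by rw [hps, hps']
      have hsplit : ch.erasures s (i + (k + 1) + r) = ch.erasures s' (i + r)
          + (Finset.univ.filter fun a => ch.noise (p a) (p (a + 1)) = true).card := by
        unfold erasures
        rw [Finset.sum_range_add, Finset.sum_range_add _ i (k + 1), Finset.sum_range_add _ i r,
          hcycle]
        have e1 : ∑ x ∈ Finset.range i, (if ch.noise (s' x) (s' (x + 1)) = true then 1 else 0)
            = ∑ x ∈ Finset.range i, (if ch.noise (s x) (s (x + 1)) = true then 1 else 0) :=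
          Finset.sum_congr rfl fun x hx => by
            have := Finset.mem_range.1 hx
            rw [h1 x this.le, h1 (x + 1) this]
        have e2 : ∑ x ∈ Finset.range r,
              (if ch.noise (s' (i + x)) (s' (i + x + 1)) = true then 1 else 0)
            = ∑ x ∈ Finset.range r, (if ch.noise (s (i + (k + 1) + x)) (s (i + (k + 1) + x + 1))
              = true then 1 else 0) :=
          Finset.sum_congr rfl fun x _ => by rw [h2, add_assoc i x 1, h2]; rfl
        rw [e1, e2]
        ring
      have hratio := ch.cycleRatio_le_maximalRatio hp
      rw [cycleRatio, div_le_iff₀ (by positivity)] at hratio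
      have hrec := ih (i + r) (by omega) hwalk
      rw [hsplit]
      push_cast at hratio hrec ⊢
      linarith

theorem exists_edge [Nonempty S] (s : S) : ∃ s', ch.edge s s' := by
  obtain ⟨s', h, -⟩ := Relation.TransGen.head'_iff.1 (ch.stronglyConnected s s)
  exact ⟨s', h⟩

theorem exists_isCycle [Fintype S] [Nonempty S] :
    ∃ (k : ℕ) (p : Fin (k + 1) → S), ch.IsCycle p := by
  choose next hnext using ch.exists_edge
  obtain ⟨s₀⟩ := ‹Nonempty S›
  obtain ⟨-, k, -, -, p, hp, -⟩ := ch.exists_isCycle_of_walk (T := Fintype.card S)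
    (s := fun t => next^[t] s₀) (fun t _ => by
      rw [Function.iterate_succ_apply']; exact hnext _) le_rfl
  exact ⟨k, p, hp⟩

theorem noiseSequences_nonempty [Nonempty S] : ch.noiseSequences.Nonempty := by
  choose next hnext using ch.exists_edge
  obtain ⟨s₀⟩ := ‹Nonempty S›
  refine ⟨_, fun t => next^[t] s₀, fun t => ⟨?_, rfl⟩⟩
  dsimp only
  rw [Function.iterate_succ_apply']; exact hnext _

theorem shift_mem_noiseSequences {z : ℕ → Bool} (hz : z ∈ ch.noiseSequences) (t₀ : ℕ) :
    (fun t => z (t₀ + t)) ∈ ch.noiseSequences := by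
  obtain ⟨s, hs⟩ := hz
  exact ⟨fun t => s (t₀ + t), fun t => hs (t₀ + t)⟩

open Classical in
/-- The restrictions of the noise sequences to `T` consecutive times. -/
def noiseWords (T : ℕ) : Finset (Fin T → Bool) :=
  Finset.univ.filter fun u => ∃ z ∈ ch.noiseSequences, u = fun i : Fin T => z i

theorem mem_noiseWords_iff {T : ℕ} {u : Fin T → Bool} :
    u ∈ ch.noiseWords T ↔ ∃ z ∈ ch.noiseSequences, u = fun i : Fin T => z i := by
  simp [noiseWords]

theorem mem_noiseWords {T : ℕ} {z : ℕ → Bool} (hz : z ∈ ch.noiseSequences) (t₀ : ℕ) :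
    (fun i : Fin T => z (t₀ + i)) ∈ ch.noiseWords T :=
  (mem_noiseWords_iff ch).2 ⟨_, ch.shift_mem_noiseSequences hz t₀, rfl⟩

section WordCount

variable [Fintype S]

open Classical in
/-- The label sequences of the walks with `T` edges that start at a given state. -/
def wordsFrom : ℕ → S → Finset (List Bool)
  | 0, _ => {[]}
  | T + 1, s => (Finset.univ.filter (ch.edge s)).biUnion fun s' =>
      (wordsFrom T s').image (List.cons (ch.noise s s'))

open Classical in
/-- The number of walks with `T` edges that start at a given state. -/
def walkCount : ℕ → S → ℕ
  | 0, _ => 1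
  | T + 1, s => ∑ s' ∈ Finset.univ.filter (ch.edge s), walkCount T s'

theorem card_wordsFrom_le (T : ℕ) (s : S) : (ch.wordsFrom T s).card ≤ ch.walkCount T s := by
  classical
  induction T generalizing s with
  | zero => simp [wordsFrom, walkCount]
  | succ T ih =>
    rw [wordsFrom, walkCount]
    refine Finset.card_biUnion_le.trans (Finset.sum_le_sum fun s' _ => ?_)
    exact Finset.card_image_le.trans (ih s')

theorem ofFn_mem_wordsFrom (T : ℕ) {s : ℕ → S} {z : ℕ → Bool}
    (hs : ∀ t, ch.edge (s t) (s (t + 1)) ∧ z t = ch.noise (s t) (s (t + 1))) :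
    List.ofFn (fun i : Fin T => z i) ∈ ch.wordsFrom T (s 0) := by
  classical
  induction T generalizing s z with
  | zero => simp [wordsFrom]
  | succ T ih =>
    rw [wordsFrom, List.ofFn_succ, Finset.mem_biUnion]
    refine ⟨s 1, by simpa using (hs 0).1, Finset.mem_image.2 ⟨_, ih
      (s := fun t => s (t + 1)) (z := fun t => z (t + 1)) fun t => hs (t + 1), ?_⟩⟩
    simpa using (hs 0).2.symm

theorem one_le_walkCount [Nonempty S] (T : ℕ) (s : S) : 1 ≤ ch.walkCount T s := by
  classical
  induction T generalizing s with
  | zero => simp [walkCount]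
  | succ T ih =>
    obtain ⟨s', hs'⟩ := ch.exists_edge s
    rw [walkCount]
    exact (ih s').trans (Finset.single_le_sum (f := ch.walkCount T) (fun _ _ => Nat.zero_le _)
      (by simpa using hs'))

open Classical in
theorem walkCount_eq (T : ℕ) (s : S) :
    (ch.walkCount T s : ℂ) = ((ch.adjacencyMatrix ^ T) *ᵥ fun _ => 1) s := by
  induction T generalizing s with
  | zero => simp [walkCount]
  | succ T ih =>
    rw [pow_succ', ← Matrix.mulVec_mulVec, walkCount]
    simp [Matrix.mulVec, dotProduct, adjacencyMatrix, Finset.sum_filter, ih]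

open Classical in
/-- The largest modulus of an eigenvalue of the adjacency matrix. -/
def perronEigenvalue : ℝ := (spectralRadius ℂ ch.adjacencyMatrix).toReal

-- The walk count is a row sum of the T-th power, hence at most its norm induced by the sup norm.
open scoped Matrix.Norms.Operator in
open Classical in
theorem walkCount_le_norm (T : ℕ) (s : S) : (ch.walkCount T s : ℝ) ≤ ‖ch.adjacencyMatrix ^ T‖ := by
  have : Nonempty S := ⟨s⟩
  have h1 : (ch.walkCount T s : ℝ) = ‖(ch.walkCount T s : ℂ)‖ := by simp
  rw [h1, walkCount_eq]
  refine (norm_le_pi_norm _ s).trans ((Matrix.linfty_opNorm_mulVec _ _).trans ?_)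
  rw [pi_norm_const, norm_one, mul_one]

open scoped Matrix.Norms.Operator in
open Classical in
theorem spectralRadius_ne_top [Nonempty S] : spectralRadius ℂ ch.adjacencyMatrix ≠ ⊤ :=
  ((spectrum.spectralRadius_le_nnnorm _).trans_lt ENNReal.coe_lt_top).ne

open scoped Matrix.Norms.Operator in
theorem one_le_perronEigenvalue [Nonempty S] : 1 ≤ ch.perronEigenvalue := by
  classical
  obtain ⟨s⟩ := ‹Nonempty S›
  have : Nonempty S := ⟨s⟩
  have h := spectrum.pow_norm_pow_one_div_tendsto_nhds_spectralRadius ch.adjacencyMatrix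
  have h1 : 1 ≤ spectralRadius ℂ ch.adjacencyMatrix := by
    refine ge_of_tendsto' h fun T => ?_
    rw [ENNReal.one_le_ofReal]
    refine Real.one_le_rpow (le_trans ?_ (ch.walkCount_le_norm T s)) (by positivity)
    exact_mod_cast ch.one_le_walkCount T s
  rw [perronEigenvalue, ← ENNReal.toReal_one]
  exact ENNReal.toReal_mono ch.spectralRadius_ne_top h1

-- Gelfand's formula: the T-th root of the norm of the T-th power tends to the spectral radius,
-- which is below ρ.
open scoped Matrix.Norms.Operator in
theorem eventually_walkCount_le [Nonempty S] {ρ : ℝ} (hρ : ch.perronEigenvalue < ρ) :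
    ∀ᶠ T : ℕ in Filter.atTop, ∀ s, (ch.walkCount T s : ℝ) ≤ ρ ^ T := by
  classical
  have h := spectrum.pow_norm_pow_one_div_tendsto_nhds_spectralRadius ch.adjacencyMatrix
  have hlt : spectralRadius ℂ ch.adjacencyMatrix < ENNReal.ofReal ρ :=
    (ENNReal.lt_ofReal_iff_toReal_lt ch.spectralRadius_ne_top).2 hρ
  have hρ0 : 0 < ρ := lt_trans (by linarith [ch.one_le_perronEigenvalue]) hρ
  filter_upwards [h.eventually (gt_mem_nhds hlt), Filter.eventually_gt_atTop 0] with T hT hT0 s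
  refine (ch.walkCount_le_norm T s).trans ?_
  rw [ENNReal.ofReal_lt_ofReal_iff hρ0] at hT
  have hT' : (T : ℝ) ≠ 0 := by exact_mod_cast hT0.ne'
  calc ‖ch.adjacencyMatrix ^ T‖ = (‖ch.adjacencyMatrix ^ T‖ ^ (1 / T : ℝ)) ^ T := by
        rw [← Real.rpow_natCast, ← Real.rpow_mul (norm_nonneg _), one_div_mul_cancel hT',
          Real.rpow_one]
    _ ≤ ρ ^ T := by gcongr

theorem card_noiseWords_le (T : ℕ) : (ch.noiseWords T).card ≤ ∑ s, ch.walkCount T s := by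
  classical
  calc (ch.noiseWords T).card ≤ (Finset.univ.biUnion (ch.wordsFrom T)).card := by
        refine Finset.card_le_card_of_injOn (fun u => List.ofFn u) ?_ List.ofFn_injective.injOn
        intro u hu
        obtain ⟨z, ⟨s, hs⟩, rfl⟩ := ch.mem_noiseWords_iff.1 hu
        exact Finset.mem_coe.2 (Finset.mem_biUnion.2
          ⟨s 0, Finset.mem_univ _, ch.ofFn_mem_wordsFrom T hs⟩)
    _ ≤ ∑ s, (ch.wordsFrom T s).card := Finset.card_biUnion_le
    _ ≤ _ := Finset.sum_le_sum fun s _ => ch.card_wordsFrom_le T s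

theorem card_erased_le {T : ℕ} {u : Fin T → Bool} (hu : u ∈ ch.noiseWords T) :
    ((Finset.univ.filter fun i => u i = true).card : ℝ)
      ≤ ch.maximalRatio * T + Fintype.card S := by
  obtain ⟨z, ⟨s, hs⟩, rfl⟩ := ch.mem_noiseWords_iff.1 hu
  refine le_trans (le_of_eq ?_) (ch.erasures_le T fun t _ => (hs t).1)
  rw [erasures, Finset.card_filter, Finset.sum_range]
  congr 1
  exact Finset.sum_congr rfl fun i _ => by simp only [(hs i).2]

end WordCount

end FiniteStateErasureChannel

-- Zero-error block codes

/-- The Gilbert-Varshamov bound for words of which the letters at some positions, given by one of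
the words in `W`, are erased. -/
theorem exists_erasureCode {X : Type*} [Fintype X] {T : ℕ} {W : Finset (Fin T → Bool)}
    (hW : W.Nonempty) :
    ∃ code : Finset (Fin T → X),
      Fintype.card X ^ T ≤ code.card *
        ∑ u ∈ W, Fintype.card X ^ (Finset.univ.filter fun i => u i = true).card ∧
      ∀ c ∈ code, ∀ c' ∈ code, ∀ u ∈ W, (∀ i, u i = false → c i = c' i) → c = c' := by
  classical
  let nbhd (c : Fin T → X) : Finset (Fin T → X) :=
    W.biUnion fun u => Fintype.piFinset fun i => if u i = true then Finset.univ else {c i}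
  have hmem (c c' : Fin T → X) : c' ∈ nbhd c ↔ ∃ u ∈ W, ∀ i, u i = false → c i = c' i := by
    simp only [nbhd, Finset.mem_biUnion, Fintype.mem_piFinset]
    refine exists_congr fun u => and_congr_right fun _ => forall_congr' fun i => ?_
    cases u i <;> simp [eq_comm]
  have hcard (c : Fin T → X) : (nbhd c).card
      ≤ ∑ u ∈ W, Fintype.card X ^ (Finset.univ.filter fun i => u i = true).card := by
    refine Finset.card_biUnion_le.trans (Finset.sum_le_sum fun u _ => le_of_eq ?_)
    rw [Fintype.card_piFinset, ← Finset.prod_const, Finset.prod_filter]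
    exact Finset.prod_congr rfl fun i _ => by split_ifs <;> simp
  let P (code : Finset (Fin T → X)) : Prop :=
    ∀ c ∈ code, ∀ c' ∈ code, ∀ u ∈ W, (∀ i, u i = false → c i = c' i) → c = c'
  obtain ⟨code, hcode, hmax⟩ := Finset.exists_max_image
    (Finset.univ.filter fun code : Finset (Fin T → X) => P code) Finset.card
    ⟨∅, by simp [P]⟩
  have hP : P code := (Finset.mem_filter.1 hcode).2
  refine ⟨code, ?_, hP⟩
  -- A code of maximal size admits no further word, so the sets of words confusable with its members
  -- cover everything.
  have hcover : (Finset.univ : Finset (Fin T → X)) ⊆ code.biUnion nbhd := by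
    intro x _
    by_contra hx
    simp only [Finset.mem_biUnion, not_exists, not_and, hmem] at hx
    have hxc : x ∉ code := fun h => hx x h _ hW.choose_spec fun _ _ => rfl
    have hins : P (insert x code) := by
      intro c hc c' hc' u hu h
      rcases Finset.mem_insert.1 hc with hcx | hc <;>
        rcases Finset.mem_insert.1 hc' with hcx' | hc'
      · rw [hcx, hcx']
      · exact absurd (fun i hi => by rw [← hcx, h i hi]) (hx c' hc' u hu)
      · exact absurd (fun i hi => by rw [← hcx', h i hi]) (hx c hc u hu)
      · exact hP c hc c' hc' u hu h
    have := hmax _ (Finset.mem_filter.2 ⟨Finset.mem_univ _, hins⟩)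
    rw [Finset.card_insert_of_notMem hxc] at this
    omega
  calc Fintype.card X ^ T = (Finset.univ : Finset (Fin T → X)).card := by simp
    _ ≤ (code.biUnion nbhd).card := Finset.card_le_card hcover
    _ ≤ ∑ c ∈ code, (nbhd c).card := Finset.card_biUnion_le
    _ ≤ ∑ _c ∈ code, _ := Finset.sum_le_sum fun c _ => hcard c
    _ = _ := by rw [Finset.sum_const, smul_eq_mul]

/-- Each confusion set has at most |S| ρ^T q^(τT + |S|) words for any ρ > λ and large T. Since R ρ
q^τ < q for some such ρ, the quotient of q^T by this bound outgrows every multiple of R^T. -/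
theorem FiniteStateErasureChannel.eventually_exists_zeroErrorCode {X S : Type*} [Fintype X]
    [Fintype S] [Nonempty S] (hq : 2 ≤ Fintype.card X) (ch : FiniteStateErasureChannel S)
    {R : ℝ} (hR : 1 ≤ R)
    (h : R * ch.perronEigenvalue * (Fintype.card X : ℝ) ^ ch.maximalRatio < Fintype.card X)
    (L : ℝ) :
    ∀ᶠ T : ℕ in Filter.atTop, ∃ code : Finset (Fin T → X), L * R ^ T + 1 ≤ code.card ∧
      ∀ c ∈ code, ∀ c' ∈ code, ∀ z ∈ ch.noiseSequences, ∀ t₀ : ℕ,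
        (∀ i : Fin T, z (t₀ + i) = false → c i = c' i) → c = c' := by
  classical
  set q : ℝ := (Fintype.card X : ℝ) with hqdef
  have hq1 : 1 ≤ q := by rw [hqdef]; exact_mod_cast (by omega : 1 ≤ Fintype.card X)
  have hq0 : 0 < q := by linarith
  have hqτ : 0 < q ^ ch.maximalRatio := Real.rpow_pos_of_pos hq0 _
  have hR0 : 0 < R := by linarith
  obtain ⟨ρ, hρ, hρq⟩ : ∃ ρ, ch.perronEigenvalue < ρ ∧ R * ρ * q ^ ch.maximalRatio < q := by
    obtain ⟨ρ, h1, h2⟩ := exists_between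
      ((lt_div_iff₀ (by positivity : 0 < R * q ^ ch.maximalRatio)).2
        (by linarith : ch.perronEigenvalue * (R * q ^ ch.maximalRatio) < q))
    refine ⟨ρ, h1, ?_⟩
    rw [lt_div_iff₀ (by positivity)] at h2
    linarith
  have hρ0 : 0 < ρ := lt_trans (by linarith [ch.one_le_perronEigenvalue]) hρ
  -- The factors that do not grow with T. Using L + 1 in place of L yields the extra word, because
  -- R^T ≥ 1.
  set B : ℝ := (L + 1) * (Fintype.card S * q ^ (Fintype.card S : ℝ)) with hB
  have hgrow := (tendsto_pow_atTop_atTop_of_one_lt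
    ((one_lt_div (by positivity)).2 hρq)).eventually_ge_atTop B
  filter_upwards [ch.eventually_walkCount_le hρ, hgrow] with T hwalk hT
  have hne : (ch.noiseWords T).Nonempty := by
    obtain ⟨z, hz⟩ := ch.noiseSequences_nonempty
    exact ⟨_, ch.mem_noiseWords hz 0⟩
  obtain ⟨code, hcard, hcode⟩ := exists_erasureCode (X := X) hne
  refine ⟨code, ?_, fun c hc c' hc' z hz t₀ hzc =>
    hcode c hc c' hc' _ (ch.mem_noiseWords hz t₀) hzc⟩
  set D : ℝ := ρ ^ T * (q ^ ch.maximalRatio) ^ T * (Fintype.card S * q ^ (Fintype.card S : ℝ))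
    with hD
  have hS : (0 : ℝ) < Fintype.card S := by exact_mod_cast Fintype.card_pos
  have hqS : 0 < q ^ (Fintype.card S : ℝ) := Real.rpow_pos_of_pos hq0 _
  have hD0 : 0 < D := by positivity
  have hsum : ((∑ u ∈ ch.noiseWords T,
      Fintype.card X ^ (Finset.univ.filter fun i => u i = true).card : ℕ) : ℝ) ≤ D := by
    push_cast
    calc ∑ u ∈ ch.noiseWords T, q ^ (Finset.univ.filter fun i => u i = true).card
        ≤ ∑ _u ∈ ch.noiseWords T, q ^ (ch.maximalRatio * T + Fintype.card S) := by
          refine Finset.sum_le_sum fun u hu => ?_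
          rw [← Real.rpow_natCast]
          exact Real.rpow_le_rpow_of_exponent_le hq1 (ch.card_erased_le hu)
      _ = (ch.noiseWords T).card * ((q ^ ch.maximalRatio) ^ T * q ^ (Fintype.card S : ℝ)) := by
          rw [Finset.sum_const, nsmul_eq_mul, Real.rpow_add hq0, Real.rpow_mul hq0.le,
            Real.rpow_natCast]
      _ ≤ (Fintype.card S * ρ ^ T) * ((q ^ ch.maximalRatio) ^ T * q ^ (Fintype.card S : ℝ)) := by
          gcongr
          calc ((ch.noiseWords T).card : ℝ) ≤ ∑ s, (ch.walkCount T s : ℝ) := by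
                exact_mod_cast ch.card_noiseWords_le T
            _ ≤ ∑ _s : S, ρ ^ T := Finset.sum_le_sum fun s _ => hwalk s
            _ = _ := by rw [Finset.sum_const, nsmul_eq_mul, Finset.card_univ]
      _ = D := by rw [hD]; ring
  have h1 : q ^ T ≤ code.card * D := by
    calc q ^ T ≤ code.card * ((∑ u ∈ ch.noiseWords T,
          Fintype.card X ^ (Finset.univ.filter fun i => u i = true).card : ℕ) : ℝ) := by
          rw [hqdef]; exact_mod_cast hcard
      _ ≤ _ := by gcongr
  have h2 : (L + 1) * R ^ T * D ≤ q ^ T := by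
    rw [div_pow, le_div_iff₀ (by positivity)] at hT
    calc (L + 1) * R ^ T * D = B * (R * ρ * q ^ ch.maximalRatio) ^ T := by
          rw [hD, hB, mul_pow, mul_pow]; ring
      _ ≤ _ := hT
  have h3 : (L + 1) * R ^ T ≤ code.card := le_of_mul_le_mul_right (h2.trans h1) hD0
  have h4 : 1 ≤ R ^ T := one_le_pow₀ hR
  linarith

-- Converse: volume against the number of possible estimates

namespace LTI

variable {n m : ℕ}

/-- A real polynomial whose values at the eigenvalues of `A` tell the unstable eigenvalues from the
stable ones. -/
theorem exists_polynomial_eval_eigenvalues (A : Matrix (Fin n) (Fin n) ℝ) :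
    ∃ g : Polynomial ℝ, ∀ z ∈ eigenvalues A,
      (g.map (algebraMap ℝ ℂ)).eval z = if 1 ≤ ‖z‖ then 1 else 0 := by
  classical
  let s : Finset ℂ := (eigenvalues A).toFinset ∪ (eigenvalues A).toFinset.image (starRingEnd ℂ)
  -- The nodes are closed under conjugation, so adding the conjugate polynomial makes the
  -- coefficients real and doubles the value 1/2.
  let r : ℂ → ℂ := fun z => if 1 ≤ ‖z‖ then 1 / 2 else 0
  let G := Lagrange.interpolate s id r
  have hG (z : ℂ) (hz : z ∈ s) : G.eval z = r z :=
    Lagrange.eval_interpolate_at_node r Function.injective_id.injOn hz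
  let H := G + G.map (starRingEnd ℂ)
  obtain ⟨g, hg⟩ : ∃ g : Polynomial ℝ, g.map (algebraMap ℝ ℂ) = H := by
    rw [← Polynomial.mem_lifts, Polynomial.lifts_iff_coeff_lifts]
    intro k
    have : starRingEnd ℂ (H.coeff k) = H.coeff k := by
      simp [H, Polynomial.coeff_map, add_comm]
    obtain ⟨x, hx⟩ := Complex.conj_eq_iff_real.1 this
    exact ⟨x, hx.symm⟩
  refine ⟨g, fun z hz => ?_⟩
  have h1 : G.eval z = r z := hG z (by simp [s, hz])
  have h2 : G.eval (starRingEnd ℂ z) = r (starRingEnd ℂ z) := by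
    refine hG _ (Finset.mem_union_right _ (Finset.mem_image_of_mem _ ?_))
    simpa using hz
  have h3 : (G.map (starRingEnd ℂ)).eval z = starRingEnd ℂ (G.eval (starRingEnd ℂ z)) := by
    conv_lhs => rw [← Complex.conj_conj z]
    rw [Polynomial.eval_map_apply]
  rw [hg, Polynomial.eval_add, h1, h3, h2]
  simp only [r, RCLike.norm_conj]
  split_ifs
  · rw [map_div₀, map_one, Complex.conj_ofNat]; norm_num
  · simp

/-- With P = g(A), the matrix Φ = P A^t + (1 - P) has determinant of modulus Λ^t, and Φx - Pa =
P(A^t x - a) + (1 - P)x is bounded on the set independently of t and a. So the set lies in the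
preimage under Φ of a ball of fixed radius. P need not be a projection: only the values of g at the
eigenvalues enter the determinant. -/
theorem exists_volume_le (A : Matrix (Fin n) (Fin n) ℝ) (l K : ℝ) :
    ∃ c : ENNReal, c ≠ ⊤ ∧ ∀ (t : ℕ) (a : Fin n → ℝ),
      MeasureTheory.volume {x : Fin n → ℝ | ‖x‖ ≤ l ∧ ‖a - (A ^ t) *ᵥ x‖ ≤ K}
        ≤ ENNReal.ofReal ((unstableProduct A ^ t)⁻¹) * c := by
  obtain ⟨g, hg⟩ := exists_polynomial_eval_eigenvalues A
  set P := Polynomial.aeval A g with hP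
  obtain ⟨c₁, hc₁, hP₁⟩ := P.exists_norm_mulVec_le
  obtain ⟨c₂, hc₂, hP₂⟩ := (1 - P).exists_norm_mulVec_le
  refine ⟨MeasureTheory.volume (Metric.closedBall (0 : Fin n → ℝ) (c₁ * K + c₂ * l)),
    (MeasureTheory.measure_closedBall_lt_top).ne, fun t a => ?_⟩
  set Φ := Polynomial.aeval A (Polynomial.X ^ t * g + (1 - g)) with hΦ
  have hΦ' : Φ = P * A ^ t + (1 - P) := by
    rw [hΦ, mul_comm]
    simp [hP]
  have hdet : |Φ.det| = unstableProduct A ^ t := by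
    have h1 : ((Φ.det : ℝ) : ℂ) = ((eigenvalues A).map fun z =>
        ((Polynomial.X ^ t * g + (1 - g)).map (algebraMap ℝ ℂ)).eval z).prod := by
      rw [eigenvalues, ← Matrix.det_aeval_eq_prod_roots_charpoly]
      have h2 := RingHom.map_det (algebraMap ℝ ℂ) Φ
      rw [hΦ, RingHom.mapMatrix_apply] at h2
      refine h2.trans (congrArg Matrix.det ?_)
      have h3 := Polynomial.hom_eval₂ (Polynomial.X ^ t * g + (1 - g))
        (algebraMap ℝ (Matrix (Fin n) (Fin n) ℝ)) (algebraMap ℝ ℂ).mapMatrix A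
      rw [Polynomial.aeval_def, Polynomial.aeval_def, Polynomial.eval₂_map]
      refine h3.trans ?_
      congr 1
      ext r i j
      by_cases hij : i = j <;> simp [Matrix.algebraMap_eq_diagonal, hij]
    have h4 : ((eigenvalues A).map fun z =>
        ((Polynomial.X ^ t * g + (1 - g)).map (algebraMap ℝ ℂ)).eval z)
        = (eigenvalues A).map fun z => if 1 ≤ ‖z‖ then z ^ t else 1 := by
      refine Multiset.map_congr rfl fun z hz => ?_
      have := hg z hz
      simp only [Polynomial.map_add, Polynomial.map_mul, Polynomial.map_pow, Polynomial.map_X,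
        Polynomial.map_sub, Polynomial.map_one, Polynomial.eval_add, Polynomial.eval_mul,
        Polynomial.eval_pow, Polynomial.eval_X, Polynomial.eval_sub, Polynomial.eval_one, this]
      split_ifs <;> simp
    have h5 : |Φ.det| = ‖((Φ.det : ℝ) : ℂ)‖ := by simp
    rw [h5, h1, h4, ← coe_nnnorm, ← nnnormHom_apply, map_multiset_prod, unstableProduct,
      ← Multiset.prod_map_pow, Multiset.map_map, ← NNReal.coe_toRealHom, map_multiset_prod,
      Multiset.map_map]
    congr 1
    refine Multiset.map_congr rfl fun z _ => ?_
    simp only [Function.comp_apply, nnnormHom_apply, NNReal.coe_toRealHom, coe_nnnorm]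
    split_ifs with h
    · rw [max_eq_right h, norm_pow]
    · rw [max_eq_left (not_le.1 h).le]; simp
  have hpos : 0 < unstableProduct A ^ t :=
    pow_pos (lt_of_lt_of_le one_pos (one_le_unstableProduct A)) t
  have hdet0 : LinearMap.det (Matrix.toLin' Φ) ≠ 0 := by
    rw [LinearMap.det_toLin', ← abs_pos, hdet]; exact hpos
  have hsub : {x : Fin n → ℝ | ‖x‖ ≤ l ∧ ‖a - (A ^ t) *ᵥ x‖ ≤ K}
      ⊆ Matrix.toLin' Φ ⁻¹' Metric.closedBall (P *ᵥ a) (c₁ * K + c₂ * l) := by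
    rintro x ⟨hx, hxa⟩
    rw [Set.mem_preimage, Metric.mem_closedBall, dist_eq_norm, Matrix.toLin'_apply]
    have h1 : Φ *ᵥ x - P *ᵥ a = P *ᵥ ((A ^ t) *ᵥ x - a) + (1 - P) *ᵥ x := by
      rw [hΦ', Matrix.add_mulVec, ← Matrix.mulVec_mulVec, Matrix.mulVec_sub]
      abel
    rw [h1]
    rw [norm_sub_rev] at hxa
    refine (norm_add_le _ _).trans (add_le_add ((hP₁ _).trans ?_) ((hP₂ _).trans ?_))
    · gcongr
    · gcongr
  refine (MeasureTheory.measure_mono hsub).trans (le_of_eq ?_)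
  rw [MeasureTheory.Measure.addHaar_preimage_linearMap _ hdet0, LinearMap.det_toLin', abs_inv,
    hdet, MeasureTheory.Measure.addHaar_closedBall_center]

theorem state_zero_noise (A : Matrix (Fin n) (Fin n) ℝ) (x₀ : Fin n → ℝ) (t : ℕ) :
    state A x₀ 0 t = (A ^ t) *ᵥ x₀ := by
  induction t with
  | zero => simp [state]
  | succ t ih => simp [state, ih, pow_succ']

end LTI

/-- For a fixed noise sequence the estimate is a function of the unerased symbols alone. -/
theorem CoderEstimator.exists_finset_stateEstimate_mem {n m : ℕ} {X : Type*} [Fintype X]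
    (ce : CoderEstimator n m X) (z : ℕ → Bool) (T : ℕ) :
    ∃ F : Finset (Fin n → ℝ),
      F.card ≤ Fintype.card X ^ (∑ t ∈ Finset.range T, if z t = true then 0 else 1) ∧
      ∀ y, ce.stateEstimate y z T ∈ F := by
  classical
  cases T with
  | zero => exact ⟨{0}, by simp, fun y => by simp [stateEstimate]⟩
  | succ t =>
    refine ⟨(Fintype.piFinset fun i : Fin (t + 1) =>
      if z i = true then ({none} : Finset (Option X)) else Finset.univ.image some).image
        (ce.estimate t), Finset.card_image_le.trans (le_of_eq ?_), fun y => ?_⟩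
    · rw [Fintype.card_piFinset, Finset.sum_range, ← Finset.prod_pow_eq_pow_sum]
      refine Finset.prod_congr rfl fun i _ => ?_
      split_ifs
      · simp
      · rw [Finset.card_image_of_injective _ (Option.some_injective X)]; simp
    · refine Finset.mem_image.2 ⟨fun i => ce.received y z i, ?_, rfl⟩
      rw [Fintype.mem_piFinset]
      intro i
      simp only [received, erasureOutput]
      split_ifs <;> simp

namespace FiniteStateErasureChannel

variable {S : Type*} (ch : FiniteStateErasureChannel S)

/-- The noise sequence of the walk that goes round a cycle. -/
def periodicNoise {k : ℕ} (p : Fin (k + 1) → S) (t : ℕ) : Bool :=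
  ch.noise (p (Fin.ofNat (k + 1) t)) (p (Fin.ofNat (k + 1) t + 1))

theorem periodicNoise_mem {k : ℕ} {p : Fin (k + 1) → S} (hp : ch.IsCycle p) :
    ch.periodicNoise p ∈ ch.noiseSequences := by
  have h (t : ℕ) : Fin.ofNat (k + 1) (t + 1) = Fin.ofNat (k + 1) t + 1 :=
    Fin.ext (by simp [Fin.val_add])
  refine ⟨fun t => p (Fin.ofNat (k + 1) t), fun t => ?_⟩
  dsimp only
  rw [h]
  exact ⟨hp.2 _, rfl⟩

theorem sum_periodicNoise {k : ℕ} (p : Fin (k + 1) → S) (j : ℕ) :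
    (∑ t ∈ Finset.range ((k + 1) * j), if ch.periodicNoise p t = true then 0 else 1)
      = (k + 1 - (Finset.univ.filter fun i => ch.noise (p i) (p (i + 1)) = true).card) * j := by
  induction j with
  | zero => simp
  | succ j ih =>
    have hper (t : ℕ) : ch.periodicNoise p ((k + 1) * j + t) = ch.periodicNoise p t := by
      have h : Fin.ofNat (k + 1) ((k + 1) * j + t) = Fin.ofNat (k + 1) t :=
        Fin.ext (by simp)
      rw [periodicNoise, periodicNoise, h]
    rw [mul_add, mul_one, Finset.sum_range_add, ih, mul_add, mul_one]
    congr 1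
    simp only [hper]
    rw [Finset.sum_range]
    have h1 : (Finset.univ.filter fun i => ch.noise (p i) (p (i + 1)) = true).card
        + ∑ i : Fin (k + 1), (if ch.periodicNoise p i = true then 0 else 1) = k + 1 := by
      rw [Finset.card_filter, ← Finset.sum_add_distrib]
      calc _ = ∑ _i : Fin (k + 1), 1 := Finset.sum_congr rfl fun i _ => by
            have h2 : ch.periodicNoise p i = ch.noise (p i) (p (i + 1)) := by
              simp [periodicNoise]
            rw [h2]; split_ifs <;> rfl
        _ = k + 1 := by simp
    omega

end FiniteStateErasureChannel

/-- If fewer than `unstableProduct A` values per time step reach the estimator on average, then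
the estimation error is unbounded for some initial state near the origin. -/
theorem CoderEstimator.exists_not_bddAbove_estimationError {n m : ℕ} {X : Type*} [Fintype X]
    (ce : CoderEstimator n m X) (A : Matrix (Fin n) (Fin n) ℝ) (C : Matrix (Fin m) (Fin n) ℝ)
    {z : ℕ → Bool} {p b : ℕ}
    (hz : ∀ j, (∑ t ∈ Finset.range (p * j), if z t = true then 0 else 1) = b * j)
    (hlt : (Fintype.card X : ℝ) ^ b < LTI.unstableProduct A ^ p) {l : ℝ} (hl : 0 < l) :
    ∃ x₀ ∈ Metric.closedBall (0 : Fin n → ℝ) l,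
      ¬ BddAbove (Set.range fun t => ‖ce.estimationError A C x₀ 0 0 z t‖) := by
  by_contra! hcon
  let E (K : ℕ) : Set (Fin n → ℝ) :=
    {x | ‖x‖ ≤ l ∧ ∀ t, ‖ce.estimationError A C x 0 0 z t‖ ≤ K}
  have hcover : Metric.closedBall (0 : Fin n → ℝ) l ⊆ ⋃ K, E K := by
    intro x hx
    obtain ⟨M, hM⟩ := hcon x hx
    obtain ⟨K, hK⟩ := exists_nat_ge M
    exact Set.mem_iUnion.2 ⟨K, mem_closedBall_zero_iff.1 hx, fun t =>
      (hM (Set.mem_range_self t)).trans hK⟩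
  have hΛ : 0 < LTI.unstableProduct A := lt_of_lt_of_le one_pos (LTI.one_le_unstableProduct A)
  have hnull (K : ℕ) : MeasureTheory.volume (E K) = 0 := by
    obtain ⟨c, hc, hvol⟩ := LTI.exists_volume_le A l K
    set θ : ℝ := (Fintype.card X : ℝ) ^ b / LTI.unstableProduct A ^ p with hθ
    have hθ0 : 0 ≤ θ := by positivity
    have hθ1 : θ < 1 := (div_lt_one (by positivity)).2 hlt
    -- At time pj there are at most q^(bj) possible estimates, each accounting for volume at most c
    -- Λ^(-pj).
    have hle (j : ℕ) : MeasureTheory.volume (E K) ≤ ENNReal.ofReal (θ ^ j) * c := by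
      obtain ⟨F, hF, hFmem⟩ := ce.exists_finset_stateEstimate_mem z (p * j)
      rw [hz] at hF
      have hsub : E K ⊆ ⋃ a ∈ F, {x | ‖x‖ ≤ l ∧ ‖a - (A ^ (p * j)) *ᵥ x‖ ≤ K} := by
        rintro x ⟨hx, hxK⟩
        have := hxK (p * j)
        rw [estimationError, LTI.state_zero_noise] at this
        exact Set.mem_iUnion₂.2 ⟨_, hFmem _, hx, this⟩
      calc MeasureTheory.volume (E K)
          ≤ ∑ a ∈ F, MeasureTheory.volume {x | ‖x‖ ≤ l ∧ ‖a - (A ^ (p * j)) *ᵥ x‖ ≤ K} :=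
            (MeasureTheory.measure_mono hsub).trans (MeasureTheory.measure_biUnion_finset_le _ _)
        _ ≤ ∑ _a ∈ F, ENNReal.ofReal ((LTI.unstableProduct A ^ (p * j))⁻¹) * c :=
            Finset.sum_le_sum fun a _ => hvol _ a
        _ = ENNReal.ofReal (F.card) * ENNReal.ofReal ((LTI.unstableProduct A ^ (p * j))⁻¹) * c := by
            rw [Finset.sum_const, nsmul_eq_mul, ENNReal.ofReal_natCast, mul_assoc]
        _ ≤ ENNReal.ofReal (θ ^ j) * c := by
            rw [← ENNReal.ofReal_mul (by positivity)]
            gcongr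
            calc (F.card : ℝ) * (LTI.unstableProduct A ^ (p * j))⁻¹
                ≤ ((Fintype.card X : ℝ) ^ (b * j)) * (LTI.unstableProduct A ^ (p * j))⁻¹ := by
                  gcongr; exact_mod_cast hF
              _ = θ ^ j := by rw [hθ, div_pow, ← pow_mul, ← pow_mul, div_eq_mul_inv]
    have hlim : Filter.Tendsto (fun j : ℕ => ENNReal.ofReal (θ ^ j) * c) Filter.atTop
        (nhds (ENNReal.ofReal 0 * c)) :=
      ENNReal.Tendsto.mul_const
        (ENNReal.tendsto_ofReal (tendsto_pow_atTop_nhds_zero_of_lt_one hθ0 hθ1)) (Or.inr hc)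
    rw [ENNReal.ofReal_zero, zero_mul] at hlim
    exact le_antisymm (ge_of_tendsto' hlim hle) zero_le
  have hzero : MeasureTheory.volume (Metric.closedBall (0 : Fin n → ℝ) l) = 0 :=
    MeasureTheory.measure_mono_null hcover (MeasureTheory.measure_iUnion_null hnull)
  exact (Metric.measure_closedBall_pos MeasureTheory.volume (0 : Fin n → ℝ) hl).ne' hzero

/-- A cycle of k + 1 edges with e erasures and e/(k + 1) > 1 - h_lin lets k + 1 - e symbols through
per turn, and q^(k+1-e) < Λ^(k+1). -/
theorem exists_unbounded_estimationError {n m : ℕ} {X S : Type*} [Fintype X] [Fintype S]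
    [Nonempty S] (hq : 2 ≤ Fintype.card X) (A : Matrix (Fin n) (Fin n) ℝ)
    (C : Matrix (Fin m) (Fin n) ℝ) (ch : FiniteStateErasureChannel S)
    (h : 1 < LTI.topologicalEntropy A (Fintype.card X) + ch.maximalRatio)
    (ce : CoderEstimator n m X) {l : ℝ} (hl : 0 < l) :
    ∃ x₀ ∈ Metric.closedBall (0 : Fin n → ℝ) l, ∃ z ∈ ch.noiseSequences,
      ¬ BddAbove (Set.range fun t => ‖ce.estimationError A C x₀ 0 0 z t‖) := by
  have hq1 : (1 : ℝ) < Fintype.card X := by exact_mod_cast (by omega : 1 < Fintype.card X)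
  have hΛ : 0 < LTI.unstableProduct A := lt_of_lt_of_le one_pos (LTI.one_le_unstableProduct A)
  obtain ⟨k₀, p₀, hp₀⟩ := ch.exists_isCycle
  obtain ⟨r, ⟨k, p, hp, rfl⟩, hr⟩ := exists_lt_of_lt_csSup
    (s := {r | ∃ (k : ℕ) (p : Fin (k + 1) → S), ch.IsCycle p ∧ r = ch.cycleRatio p})
    ⟨_, k₀, p₀, hp₀, rfl⟩
    (by linarith [show ch.maximalRatio = sSup _ from rfl] :
      1 - LTI.topologicalEntropy A (Fintype.card X) < _)
  obtain ⟨x₀, hx₀, hx⟩ := ce.exists_not_bddAbove_estimationError A C (ch.sum_periodicNoise p) (by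
    set e := (Finset.univ.filter fun i => ch.noise (p i) (p (i + 1)) = true).card with he
    have hek : e ≤ k + 1 := (Finset.card_le_univ _).trans (by simp)
    rw [FiniteStateErasureChannel.cycleRatio, ← he,
      LTI.topologicalEntropy_eq_logb_unstableProduct, lt_div_iff₀ (by positivity)] at hr
    rw [← Real.rpow_natCast, ← Real.lt_logb_iff_rpow_lt hq1 (by positivity), Real.logb_pow,
      Nat.cast_sub hek]
    push_cast at hr ⊢
    linarith) hl
  exact ⟨x₀, hx₀, _, ch.periodicNoise_mem hp, hx⟩

/-! ### The zoom quantizer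

The state of the quantizer is a pair of an estimate and a scale `s`; the estimate is believed to be
within distance `s ^ 2`. Inside this range the rescaled error is quantized by an element of `F`;
otherwise the overflow symbol `none` is sent and the scale is multiplied by `b`. -/

namespace ZoomQuantizer

variable {n : ℕ} {F : Finset (Fin n → ℝ)} (B : Matrix (Fin n) (Fin n) ℝ) (b : ℝ)
  (κ : (Fin n → ℝ) → F)

/-- The symbol sent for the value `ξ`. -/
def message (σ : (Fin n → ℝ) × ℝ) (ξ : Fin n → ℝ) : Option F :=
  if ‖ξ - σ.1‖ ≤ σ.2 ^ 2 then some (κ ((σ.2 ^ 2)⁻¹ • (ξ - σ.1))) else none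

/-- The next state of the quantizer after a symbol. -/
def update (σ : (Fin n → ℝ) × ℝ) : Option F → (Fin n → ℝ) × ℝ
  | some c => (B *ᵥ σ.1 + σ.2 ^ 2 • (c : Fin n → ℝ), σ.2)
  | none => (B *ᵥ σ.1, b * σ.2)

/-- The states of the quantizer, computed from the symbols. -/
def decode (μ : ℕ → Option F) : ℕ → (Fin n → ℝ) × ℝ
  | 0 => (0, 1)
  | k + 1 => update B b (decode μ k) (μ k)

/-- The states of the quantizer, computed from the quantized signal. -/
def encode (ξ : ℕ → Fin n → ℝ) : ℕ → (Fin n → ℝ) × ℝ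
  | 0 => (0, 1)
  | k + 1 => update B b (encode ξ k) (message κ (encode ξ k) (ξ k))

theorem decode_congr {μ μ' : ℕ → Option F} {k : ℕ} (h : ∀ j < k, μ j = μ' j) :
    decode B b μ k = decode B b μ' k := by
  induction k with
  | zero => rfl
  | succ k ih => rw [decode, decode, ih fun j hj => h j (by omega), h k (by omega)]

theorem encode_congr {ξ ξ' : ℕ → Fin n → ℝ} {k : ℕ} (h : ∀ j < k, ξ j = ξ' j) :
    encode B b κ ξ k = encode B b κ ξ' k := by
  induction k with
  | zero => rfl
  | succ k ih => rw [encode, encode, ih fun j hj => h j (by omega), h k (by omega)]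

theorem decode_message (ξ : ℕ → Fin n → ℝ) (k : ℕ) :
    decode B b (fun j => message κ (encode B b κ ξ j) (ξ j)) k = encode B b κ ξ k := by
  induction k with
  | zero => rfl
  | succ k ih => rw [decode, encode, ih]

/-- The quantization error is bounded although the quantizer does not know the bound `M` on the
increments of the signal. -/
theorem exists_bound {c : ℝ} (hc : 0 ≤ c) (hB : ∀ x, ‖B *ᵥ x‖ ≤ c * ‖x‖) (hb : c + 2 ≤ b)
    (hκ : ∀ x, ‖x‖ ≤ 1 → ‖B *ᵥ x - κ x‖ ≤ 1 / 2) {M : ℝ} (hM : 0 ≤ M) :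
    ∃ K, ∀ ξ : ℕ → Fin n → ℝ, ξ 0 = 0 → (∀ k, ‖ξ (k + 1) - B *ᵥ ξ k‖ ≤ M) →
      ∀ k, ‖ξ k - (encode B b κ ξ k).1‖ ≤ K := by
  set G := 3 * M + 1 with hG
  refine ⟨G * (b * G) + (b * G) ^ 2, fun ξ hξ0 hξ => ?_⟩
  have hb2 : 2 ≤ b := by linarith
  have hG1 : 1 ≤ G := by linarith
  have hbG : 1 ≤ b * G := by nlinarith
  -- Either the error is in range, or error plus M is at most G s. Overflow forces s^2 < G s, so s <
  -- G before the zoom and s ≤ bG after it; error plus M grows by a factor at most c + 2 ≤ b.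
  -- Without overflow the new error is at most M + s^2/2: this is at most s^2 if s^2 ≥ 2M, and
  -- otherwise adding M gives at most 3M ≤ G s.
  have hinv (k : ℕ) : 1 ≤ (encode B b κ ξ k).2 ∧ (encode B b κ ξ k).2 ≤ b * G ∧
      (‖ξ k - (encode B b κ ξ k).1‖ + M ≤ G * (encode B b κ ξ k).2 ∨
        ‖ξ k - (encode B b κ ξ k).1‖ ≤ (encode B b κ ξ k).2 ^ 2) := by
    induction k with
    | zero => simp [encode, hξ0, hbG]
    | succ k ih =>
      obtain ⟨hs1, hsG, hor⟩ := ih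
      rw [encode]
      set σ := encode B b κ ξ k with hσ
      have hstep : ‖ξ (k + 1) - B *ᵥ ξ k‖ ≤ M := hξ k
      by_cases hover : ‖ξ k - σ.1‖ ≤ σ.2 ^ 2
      · rw [message, if_pos hover, update]
        have hρ : 0 < σ.2 ^ 2 := by positivity
        set x := (σ.2 ^ 2)⁻¹ • (ξ k - σ.1) with hx
        have hx1 : ‖x‖ ≤ 1 := by
          rw [hx, norm_smul, norm_inv, Real.norm_of_nonneg hρ.le, inv_mul_le_iff₀ hρ]
          linarith
        have hxρ : ξ k = σ.1 + σ.2 ^ 2 • x := by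
          rw [hx, smul_smul, mul_inv_cancel₀ hρ.ne', one_smul]; abel
        have herr : ‖ξ (k + 1) - (B *ᵥ σ.1 + σ.2 ^ 2 • (κ x : Fin n → ℝ))‖
            ≤ M + σ.2 ^ 2 / 2 := by
          have h1 : ξ (k + 1) - (B *ᵥ σ.1 + σ.2 ^ 2 • (κ x : Fin n → ℝ))
              = (ξ (k + 1) - B *ᵥ ξ k) + σ.2 ^ 2 • (B *ᵥ x - κ x) := by
            conv_rhs => rw [hxρ, Matrix.mulVec_add, Matrix.mulVec_smul, smul_sub]
            abel
          rw [h1]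
          refine (norm_add_le _ _).trans (add_le_add hstep ?_)
          rw [norm_smul, Real.norm_of_nonneg hρ.le]
          calc σ.2 ^ 2 * ‖B *ᵥ x - κ x‖ ≤ σ.2 ^ 2 * (1 / 2) := by gcongr; exact hκ x hx1
            _ = σ.2 ^ 2 / 2 := by ring
        refine ⟨hs1, hsG, ?_⟩
        dsimp only
        rcases le_or_gt (2 * M) (σ.2 ^ 2) with h | h
        · right; linarith
        · left; nlinarith
      · rw [message, if_neg hover, update]
        have hleft := hor.resolve_right hover
        have hsG' : σ.2 ≤ G := by nlinarith
        have herr : ‖ξ (k + 1) - B *ᵥ σ.1‖ ≤ M + c * ‖ξ k - σ.1‖ := by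
          have h1 : ξ (k + 1) - B *ᵥ σ.1 = (ξ (k + 1) - B *ᵥ ξ k) + B *ᵥ (ξ k - σ.1) := by
            rw [Matrix.mulVec_sub]; abel
          rw [h1]
          exact (norm_add_le _ _).trans (add_le_add hstep (hB _))
        refine ⟨by dsimp only; nlinarith, by dsimp only; gcongr, Or.inl ?_⟩
        dsimp only
        have hn := norm_nonneg (ξ k - σ.1)
        calc ‖ξ (k + 1) - B *ᵥ σ.1‖ + M ≤ (c + 2) * (‖ξ k - σ.1‖ + M) := by nlinarith
          _ ≤ b * (‖ξ k - σ.1‖ + M) := by gcongr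
          _ ≤ b * (G * σ.2) := by gcongr
          _ = G * (b * σ.2) := by ring
  intro k
  obtain ⟨hs1, hsG, hor⟩ := hinv k
  have h1 : G * (encode B b κ ξ k).2 ≤ G * (b * G) := by gcongr
  have h2 : (encode B b κ ξ k).2 ^ 2 ≤ (b * G) ^ 2 := by gcongr
  have h3 : 0 ≤ G * (b * G) := by positivity
  rcases hor with h | h
  · nlinarith
  · linarith

end ZoomQuantizer

-- Reconstruction of the state from blocks of outputs

namespace LTI

variable {n m : ℕ}

theorem Observable.exists_leftInverse {C : Matrix (Fin m) (Fin n) ℝ} {A : Matrix (Fin n) (Fin n) ℝ}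
    (h : Observable C A) :
    ∃ L : (Fin n × Fin m → ℝ) →ₗ[ℝ] (Fin n → ℝ),
      ∀ x : Fin n → ℝ, L (fun ij => (C *ᵥ ((A ^ (ij.1 : ℕ)) *ᵥ x)) ij.2) = x := by
  have hker : LinearMap.ker (observabilityMatrix C A).mulVecLin = ⊥ := by
    have h1 := LinearMap.finrank_range_add_finrank_ker (observabilityMatrix C A).mulVecLin
    have h2 : Module.finrank ℝ (LinearMap.range (observabilityMatrix C A).mulVecLin) = n := h
    rw [h2, Module.finrank_fin_fun] at h1
    exact Submodule.finrank_eq_zero.1 (by omega)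
  obtain ⟨L, hL⟩ := LinearMap.exists_leftInverse_of_injective _ hker
  refine ⟨L, fun x => ?_⟩
  have h1 : (fun ij : Fin n × Fin m => (C *ᵥ ((A ^ (ij.1 : ℕ)) *ᵥ x)) ij.2)
      = (observabilityMatrix C A).mulVecLin x := by
    ext ij
    rw [Matrix.mulVec_mulVec]
    rfl
  rw [h1]
  exact LinearMap.congr_fun hL x

theorem exists_norm_pow_mulVec_le (A : Matrix (Fin n) (Fin n) ℝ) (T : ℕ) :
    ∃ c : ℝ, 0 < c ∧ ∀ i ≤ T, ∀ x, ‖(A ^ i) *ᵥ x‖ ≤ c * ‖x‖ := by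
  choose c hc hcx using fun i : ℕ => (A ^ i).exists_norm_mulVec_le
  refine ⟨∑ i ∈ Finset.range (T + 1), c i,
    Finset.sum_pos (fun i _ => hc i) ⟨0, by simp⟩, fun i hi x => (hcx i x).trans ?_⟩
  gcongr
  exact Finset.single_le_sum (f := c) (fun i _ => (hc i).le) (by simpa using Nat.lt_succ_of_le hi)

theorem exists_norm_state_sub_le (A : Matrix (Fin n) (Fin n) ℝ) {M : ℝ} (hM : 0 ≤ M) (T : ℕ) :
    ∃ D : ℝ, 0 ≤ D ∧ ∀ (x₀ : Fin n → ℝ) (v : ℕ → Fin n → ℝ), (∀ t, ‖v t‖ ≤ M) →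
      ∀ s, ∀ i ≤ T, ‖state A x₀ v (s + i) - (A ^ i) *ᵥ state A x₀ v s‖ ≤ D := by
  obtain ⟨a, ha, hA⟩ := A.exists_norm_mulVec_le
  induction T with
  | zero =>
    refine ⟨0, le_rfl, fun x₀ v _ s i hi => ?_⟩
    obtain rfl : i = 0 := by omega
    simp
  | succ T ih =>
    obtain ⟨D, hD, hDs⟩ := ih
    refine ⟨D + (a * D + M), by positivity, fun x₀ v hv s i hi => ?_⟩
    rcases Nat.lt_or_ge T i with h | h
    · obtain rfl : i = T + 1 := by omega
      have h1 : state A x₀ v (s + (T + 1)) - (A ^ (T + 1)) *ᵥ state A x₀ v s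
          = A *ᵥ (state A x₀ v (s + T) - (A ^ T) *ᵥ state A x₀ v s) + v (s + T) := by
        rw [← add_assoc, state, pow_succ', ← Matrix.mulVec_mulVec, Matrix.mulVec_sub]
        abel
      rw [h1]
      have h2 := (hA (state A x₀ v (s + T) - (A ^ T) *ᵥ state A x₀ v s)).trans
        (mul_le_mul_of_nonneg_left (hDs x₀ v hv s T le_rfl) ha.le)
      have h3 := norm_add_le (A *ᵥ (state A x₀ v (s + T) - (A ^ T) *ᵥ state A x₀ v s)) (v (s + T))
      linarith [hv (s + T)]
    · have h1 := hDs x₀ v hv s i h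
      have h2 : 0 ≤ a * D := by positivity
      linarith

/-- An estimate of the state at the times `k * T`, computed from the measurements before. -/
def blockObserver (A : Matrix (Fin n) (Fin n) ℝ) (L : (Fin n × Fin m → ℝ) →ₗ[ℝ] (Fin n → ℝ))
    (T : ℕ) (y : ℕ → Fin m → ℝ) : ℕ → Fin n → ℝ
  | 0 => 0
  | k + 1 => (A ^ T) *ᵥ L fun ij => y (k * T + ij.1) ij.2

theorem blockObserver_congr {A : Matrix (Fin n) (Fin n) ℝ}
    {L : (Fin n × Fin m → ℝ) →ₗ[ℝ] (Fin n → ℝ)} {T : ℕ} (hT : n ≤ T) {y y' : ℕ → Fin m → ℝ}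
    {k : ℕ} (h : ∀ t < k * T, y t = y' t) :
    blockObserver A L T y k = blockObserver A L T y' k := by
  cases k with
  | zero => rfl
  | succ k =>
    rw [blockObserver, blockObserver]
    congr 2
    ext ij
    rw [h _ (by rw [Nat.succ_mul]; have := ij.1.isLt; omega)]

/-- Every block is observed afresh from its first n outputs, so errors do not accumulate from block
to block. The summand 1 covers block 0, where the estimate is 0. -/
theorem exists_norm_blockObserver_sub_le {A : Matrix (Fin n) (Fin n) ℝ}
    {C : Matrix (Fin m) (Fin n) ℝ} {L : (Fin n × Fin m → ℝ) →ₗ[ℝ] (Fin n → ℝ)}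
    (hL : ∀ x : Fin n → ℝ, L (fun ij => (C *ᵥ ((A ^ (ij.1 : ℕ)) *ᵥ x)) ij.2) = x)
    {T : ℕ} (hT : n ≤ T) {M : ℝ} (hM : 0 ≤ M) :
    ∃ K : ℝ, 0 ≤ K ∧ ∀ (x₀ : Fin n → ℝ) (v : ℕ → Fin n → ℝ) (w : ℕ → Fin m → ℝ), ‖x₀‖ ≤ 1 →
      (∀ t, ‖v t‖ ≤ M) → (∀ t, ‖w t‖ ≤ M) →
      ∀ k, ‖blockObserver A L T (output A C x₀ v w) k - state A x₀ v (k * T)‖ ≤ K := by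
  obtain ⟨D, hD, hDs⟩ := exists_norm_state_sub_le A hM T
  obtain ⟨a, ha, hA⟩ := (A ^ T).exists_norm_mulVec_le
  obtain ⟨c, hc, hC⟩ := C.exists_norm_mulVec_le
  obtain ⟨d, hd, hLd⟩ := (LinearMap.toContinuousLinearMap L).bound
  refine ⟨1 + (a * (d * (c * D + M)) + D), by positivity, fun x₀ v w hx₀ hv hw k => ?_⟩
  cases k with
  | zero =>
    simp only [blockObserver, Nat.zero_mul, state, zero_sub, norm_neg]
    have : 0 ≤ a * (d * (c * D + M)) + D := by positivity
    linarith
  | succ k =>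
    rw [blockObserver]
    set x := state A x₀ v (k * T) with hx
    have h1 : ‖L (fun ij => output A C x₀ v w (k * T + ij.1) ij.2) - x‖ ≤ d * (c * D + M) := by
      conv_lhs => rw [← hL x, ← map_sub]
      refine (hLd _).trans ?_
      gcongr
      rw [pi_norm_le_iff_of_nonneg (by positivity)]
      rintro ⟨i, j⟩
      have h2 : output A C x₀ v w (k * T + i) j - (C *ᵥ ((A ^ (i : ℕ)) *ᵥ x)) j
          = (C *ᵥ (state A x₀ v (k * T + i) - (A ^ (i : ℕ)) *ᵥ x)) j + w (k * T + i) j := by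
        rw [output, Matrix.mulVec_sub]
        simp only [Pi.add_apply, Pi.sub_apply]
        ring
      simp only [Pi.sub_apply]
      rw [h2]
      refine (norm_add_le _ _).trans (add_le_add ?_ ((norm_le_pi_norm _ j).trans (hw _)))
      refine (norm_le_pi_norm _ j).trans ((hC _).trans ?_)
      gcongr
      exact hDs x₀ v hv (k * T) i (i.isLt.le.trans hT)
    have h3 := hDs x₀ v hv (k * T) T le_rfl
    have h4 : (A ^ T) *ᵥ L (fun ij => output A C x₀ v w (k * T + ij.1) ij.2)
          - state A x₀ v ((k + 1) * T)
        = (A ^ T) *ᵥ (L (fun ij => output A C x₀ v w (k * T + ij.1) ij.2) - x)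
          - (state A x₀ v (k * T + T) - (A ^ T) *ᵥ x) := by
      rw [Nat.succ_mul, Matrix.mulVec_sub]; abel
    rw [h4]
    have h5 := (hA (L (fun ij => output A C x₀ v w (k * T + ij.1) ij.2) - x)).trans
      (mul_le_mul_of_nonneg_left h1 ha.le)
    have h6 := norm_sub_le
      ((A ^ T) *ᵥ (L (fun ij => output A C x₀ v w (k * T + ij.1) ij.2) - x))
      (state A x₀ v (k * T + T) - (A ^ T) *ᵥ x)
    linarith

end LTI

-- The block coder-estimator

/-- A sequence whose first terms are given, followed by a constant. -/
def extendSequence {α : Type*} (a : α) {t : ℕ} (y : Fin t → α) (i : ℕ) : α :=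
  if h : i < t then y ⟨i, h⟩ else a

theorem extendSequence_of_lt {α : Type*} (a : α) {t : ℕ} (y : ℕ → α) {i : ℕ} (h : i < t) :
    extendSequence a (fun j : Fin t => y j) i = y i := dif_pos h

namespace CoderEstimator

variable {n m : ℕ} {X : Type*} {F : Finset (Fin n → ℝ)}

/-- The symbol of the zoom quantizer sent in the `k`-th block. -/
def blockMessage (A : Matrix (Fin n) (Fin n) ℝ) (L : (Fin n × Fin m → ℝ) →ₗ[ℝ] (Fin n → ℝ))
    (T : ℕ) (b : ℝ) (κ : (Fin n → ℝ) → F) (y : ℕ → Fin m → ℝ) (k : ℕ) : Option F :=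
  ZoomQuantizer.message κ (ZoomQuantizer.encode (A ^ T) b κ (LTI.blockObserver A L T y) k)
    (LTI.blockObserver A L T y k)

/-- The coder-estimator that sends the symbols of the zoom quantizer for the observed state in
blocks of length `T` by the block code `code` with the decoder `dec`. -/
def zoom (A : Matrix (Fin n) (Fin n) ℝ) (L : (Fin n × Fin m → ℝ) →ₗ[ℝ] (Fin n → ℝ))
    {T : ℕ} (hT : 0 < T) (b : ℝ) (κ : (Fin n → ℝ) → F) (code : Option F → Fin T → X)
    (dec : (Fin T → Option X) → Option F) : CoderEstimator n m X where
  encode t y := code (blockMessage A L T b κ (extendSequence 0 y) (t / T))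
    ⟨t % T, Nat.mod_lt t hT⟩
  estimate t Q := (A ^ ((t + 1) % T)) *ᵥ (ZoomQuantizer.decode (A ^ T) b
    (fun k => dec fun i => extendSequence none Q (k * T + i)) ((t + 1) / T)).1

variable {A : Matrix (Fin n) (Fin n) ℝ} {L : (Fin n × Fin m → ℝ) →ₗ[ℝ] (Fin n → ℝ)} {T : ℕ}
  {b : ℝ} {κ : (Fin n → ℝ) → F} {code : Option F → Fin T → X}
  {dec : (Fin T → Option X) → Option F}

/-- The message of a block depends only on measurements made before the block starts, so the padding
by 0 is never read and the message stays the same throughout the block. -/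
theorem zoom_encode (hT : 0 < T) (hnT : n ≤ T) (y : ℕ → Fin m → ℝ) (t : ℕ) :
    (zoom A L hT b κ code dec).encode t (fun i => y i)
      = code (blockMessage A L T b κ y (t / T)) ⟨t % T, Nat.mod_lt t hT⟩ := by
  have h (k : ℕ) (hk : k ≤ t / T) :
      LTI.blockObserver A L T (extendSequence 0 fun i : Fin (t + 1) => y i) k
        = LTI.blockObserver A L T y k := by
    refine LTI.blockObserver_congr hnT fun s hs => extendSequence_of_lt _ _ ?_
    have h1 := Nat.mul_le_mul_right T hk
    have h2 := Nat.div_mul_le_self t T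
    omega
  simp only [zoom, blockMessage]
  rw [h _ le_rfl, ZoomQuantizer.encode_congr _ _ _ fun j hj => h j hj.le]

/-- The blocks decoded for the estimate at time t are complete by time t - 1, so the padding by
`none` is never read. Within a block the estimate is propagated by A. -/
theorem zoom_stateEstimate (hT : 0 < T) (hnT : n ≤ T) {z : ℕ → Bool}
    (hdec : ∀ (μ : Option F) (t₀ : ℕ),
      dec (fun i : Fin T => erasureOutput (code μ i) (z (t₀ + i))) = μ)
    (y : ℕ → Fin m → ℝ) (t : ℕ) :
    (zoom A L hT b κ code dec).stateEstimate y z t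
      = (A ^ (t % T)) *ᵥ
        (ZoomQuantizer.encode (A ^ T) b κ (LTI.blockObserver A L T y) (t / T)).1 := by
  cases t with
  | zero => simp [stateEstimate, ZoomQuantizer.encode]
  | succ t =>
    rw [stateEstimate, ← ZoomQuantizer.decode_message]
    refine congrArg (fun σ : (Fin n → ℝ) × ℝ => (A ^ ((t + 1) % T)) *ᵥ σ.1)
      (ZoomQuantizer.decode_congr _ _ fun k hk => ?_)
    refine Eq.trans (congrArg dec ?_) (hdec (blockMessage A L T b κ y k) (k * T))
    ext1 i
    have hi := i.isLt
    have hlt : k * T + i < t + 1 := by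
      have h1 := Nat.mul_le_mul_right T (Nat.succ_le_of_lt hk)
      have h2 := Nat.div_mul_le_self (t + 1) T
      rw [Nat.succ_mul] at h1
      omega
    rw [extendSequence_of_lt none (fun j => (zoom A L hT b κ code dec).received y z j) hlt,
      received, zoom_encode hT hnT]
    have h1 : (k * T + i) / T = k := by
      rw [mul_comm, Nat.mul_add_div hT, Nat.div_eq_of_lt hi, add_zero]
    have h2 : (⟨(k * T + i) % T, Nat.mod_lt _ hT⟩ : Fin T) = i :=
      Fin.ext (by simp [Nat.mod_eq_of_lt hi])
    rw [h1, h2]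

theorem zoom_uniformlyBoundedErrors {C : Matrix (Fin m) (Fin n) ℝ} {S : Type*}
    {ch : FiniteStateErasureChannel S} (hT : 0 < T) (hnT : n ≤ T)
    (hL : ∀ x : Fin n → ℝ, L (fun ij => (C *ᵥ ((A ^ (ij.1 : ℕ)) *ᵥ x)) ij.2) = x)
    {c : ℝ} (hc : 0 ≤ c) (hA : ∀ x, ‖(A ^ T) *ᵥ x‖ ≤ c * ‖x‖) (hb : c + 2 ≤ b)
    (hκ : ∀ x, ‖x‖ ≤ 1 → ‖(A ^ T) *ᵥ x - κ x‖ ≤ 1 / 2)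
    (hdec : ∀ z ∈ ch.noiseSequences, ∀ (μ : Option F) (t₀ : ℕ),
      dec (fun i : Fin T => erasureOutput (code μ i) (z (t₀ + i))) = μ) :
    (zoom A L hT b κ code dec : CoderEstimator n m X).UniformlyBoundedErrors A C ch := by
  rintro RV RW ⟨MV, hMV⟩ ⟨MW, hMW⟩
  refine ⟨1, one_pos, fun RX hRX => ?_⟩
  set M := |MV| + |MW| with hM
  have hM0 : 0 ≤ M := by positivity
  obtain ⟨K₁, hK₁, hobs⟩ := LTI.exists_norm_blockObserver_sub_le hL hnT hM0
  obtain ⟨D, hD, hDs⟩ := LTI.exists_norm_state_sub_le A hM0 T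
  obtain ⟨a, ha, hAa⟩ := LTI.exists_norm_pow_mulVec_le A T
  -- The quantized signal is the observed state ξ. It satisfies ξ(k+1) = A^T ξ(k) up to the two
  -- observation errors K₁ and c K₁ and the process noise D collected over a block.
  obtain ⟨K₂, hK₂⟩ := ZoomQuantizer.exists_bound (A ^ T) b κ hc hA hb hκ
    (M := K₁ + D + c * K₁) (by positivity)
  refine ⟨a * (K₂ + K₁) + D, fun x₀ hx₀ v hv w hw z hz t => ?_⟩
  have hx₀' : ‖x₀‖ ≤ 1 := mem_closedBall_zero_iff.1 (hRX hx₀)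
  have hv' (t : ℕ) : ‖v t‖ ≤ M := by
    linarith [hMV v hv t, le_abs_self MV, abs_nonneg MW]
  have hw' (t : ℕ) : ‖w t‖ ≤ M := by
    linarith [hMW w hw t, le_abs_self MW, abs_nonneg MV]
  set ξ := LTI.blockObserver A L T (LTI.output A C x₀ v w) with hξ
  have hξX (k : ℕ) : ‖ξ k - LTI.state A x₀ v (k * T)‖ ≤ K₁ := hobs x₀ v w hx₀' hv' hw' k
  have hquant := hK₂ ξ rfl (fun k => by
    have h1 : ξ (k + 1) - (A ^ T) *ᵥ ξ k
        = (ξ (k + 1) - LTI.state A x₀ v ((k + 1) * T))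
          + (LTI.state A x₀ v (k * T + T) - (A ^ T) *ᵥ LTI.state A x₀ v (k * T))
          - (A ^ T) *ᵥ (ξ k - LTI.state A x₀ v (k * T)) := by
      rw [Nat.succ_mul, Matrix.mulVec_sub]; abel
    rw [h1]
    refine (norm_sub_le _ _).trans (add_le_add ((norm_add_le _ _).trans (add_le_add (hξX _)
      (hDs x₀ v hv' _ T le_rfl))) ((hA _).trans ?_))
    gcongr
    exact hξX k) (t / T)
  rw [estimationError, zoom_stateEstimate hT hnT (hdec z hz), ← hξ]
  set xh := (ZoomQuantizer.encode (A ^ T) b κ ξ (t / T)).1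
  have hr : t % T ≤ T := (Nat.mod_lt t hT).le
  have ht : t / T * T + t % T = t := Nat.div_add_mod' t T
  have hX := hDs x₀ v hv' (t / T * T) (t % T) hr
  rw [ht] at hX
  set x := LTI.state A x₀ v (t / T * T) with hx
  have hsplit : (A ^ (t % T)) *ᵥ xh - LTI.state A x₀ v t
      = (A ^ (t % T)) *ᵥ ((ξ (t / T) - x) - (ξ (t / T) - xh))
        - (LTI.state A x₀ v t - (A ^ (t % T)) *ᵥ x) := by
    have : (ξ (t / T) - x) - (ξ (t / T) - xh) = xh - x := by abel
    rw [this, Matrix.mulVec_sub]; abel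
  rw [hsplit]
  refine (norm_sub_le _ _).trans (add_le_add ((hAa _ hr _).trans ?_) hX)
  gcongr
  refine (norm_sub_le _ _).trans ?_
  linarith [hξX (t / T)]

end CoderEstimator

theorem exists_uniformlyBoundedErrors {n m : ℕ} {X S : Type*} [Fintype X] [Fintype S]
    [Nonempty S] (hq : 2 ≤ Fintype.card X) {A : Matrix (Fin n) (Fin n) ℝ}
    {C : Matrix (Fin m) (Fin n) ℝ} (hobs : LTI.Observable C A) (ch : FiniteStateErasureChannel S)
    (h : LTI.topologicalEntropy A (Fintype.card X) + ch.topologicalEntropy (Fintype.card X)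
        + ch.maximalRatio < 1) :
    ∃ ce : CoderEstimator n m X, ce.UniformlyBoundedErrors A C ch := by
  classical
  have hq1 : (1 : ℝ) < Fintype.card X := by exact_mod_cast (by omega : 1 < Fintype.card X)
  have hq0 : (0 : ℝ) < Fintype.card X := by linarith
  have hΛ := LTI.one_le_unstableProduct A
  have hΛ0 : 0 < LTI.unstableProduct A := by linarith
  have hch1 := ch.one_le_perronEigenvalue
  have hch0 : 0 < ch.perronEigenvalue := by linarith
  have hqτ : 0 < (Fintype.card X : ℝ) ^ ch.maximalRatio := Real.rpow_pos_of_pos hq0 _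
  have hprod : LTI.unstableProduct A *
      (ch.perronEigenvalue * (Fintype.card X : ℝ) ^ ch.maximalRatio)
      < Fintype.card X := by
    rw [LTI.topologicalEntropy_eq_logb_unstableProduct] at h
    have h1 : Real.logb (Fintype.card X) (LTI.unstableProduct A *
        (ch.perronEigenvalue * (Fintype.card X : ℝ) ^ ch.maximalRatio)) < 1 := by
      rw [Real.logb_mul hΛ0.ne' (by positivity), Real.logb_mul hch0.ne' hqτ.ne',
        Real.logb_rpow hq0 hq1.ne', ← add_assoc]
      exact h
    rw [Real.logb_lt_iff_lt_rpow hq1 (by positivity), Real.rpow_one] at h1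
    exact h1
  obtain ⟨R, hR, hRq⟩ := exists_between
    ((lt_div_iff₀ (by positivity)).2 hprod)
  rw [lt_div_iff₀ (by positivity), ← mul_assoc] at hRq
  obtain ⟨k, hk, K, -, hcover⟩ := LTI.exists_finset_cover_pow A hR
  have htend : Filter.Tendsto (fun j : ℕ => k * j) Filter.atTop Filter.atTop :=
    Filter.tendsto_id.const_mul_atTop' hk
  obtain ⟨j, ⟨words, hwords, hzero⟩, hj⟩ :=
    ((htend.eventually (ch.eventually_exists_zeroErrorCode hq (hΛ.trans hR.le) hRq K)).and
      (htend.eventually (Filter.eventually_ge_atTop (n + 1)))).exists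
  obtain ⟨F, hF, hFx⟩ := hcover j
  generalize k * j = T at *
  have hcard : Fintype.card (Option F) ≤ Fintype.card words := by
    rw [Fintype.card_option, Fintype.card_coe, Fintype.card_coe]
    have : ((F.card + 1 : ℕ) : ℝ) ≤ words.card := by push_cast; linarith
    exact_mod_cast this
  obtain ⟨e⟩ := Function.Embedding.nonempty_of_card_le hcard
  -- Erasures are visible in the output, so equal outputs under two noise sequences have the same
  -- erased positions, and the code words agree elsewhere.
  have hdec_ex (Q : Fin T → Option X) : ∃ μ : Option F, ∀ z ∈ ch.noiseSequences,
      ∀ (ν : Option F) (t₀ : ℕ),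
        Q = (fun i : Fin T => erasureOutput ((e ν : Fin T → X) i) (z (t₀ + i))) → μ = ν := by
    by_cases hQ : ∃ z ∈ ch.noiseSequences, ∃ (ν : Option F) (t₀ : ℕ),
        Q = fun i : Fin T => erasureOutput ((e ν : Fin T → X) i) (z (t₀ + i))
    · obtain ⟨z, hz, ν, t₀, rfl⟩ := hQ
      refine ⟨ν, fun z' hz' ν' t₀' heq => e.injective (Subtype.ext ?_)⟩
      refine hzero _ (e ν).2 _ (e ν').2 z hz t₀ fun i hi => ?_
      have h1 := congrFun heq i
      simp only [erasureOutput, hi] at h1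
      by_cases hi' : z' (t₀' + i) = true
      · simp [hi'] at h1
      · simpa [hi'] using h1
    · exact ⟨none, fun z hz ν t₀ h => absurd ⟨z, hz, ν, t₀, h⟩ hQ⟩
  choose dec hdec using hdec_ex
  have hκ_ex (x : Fin n → ℝ) : ∃ c : F, ‖x‖ ≤ 1 → ‖(A ^ T) *ᵥ x - c‖ ≤ 1 / 2 := by
    by_cases hx : ‖x‖ ≤ 1
    · obtain ⟨c, hc, hcx⟩ := hFx x hx
      exact ⟨⟨c, hc⟩, fun _ => hcx⟩
    · obtain ⟨c, hc, -⟩ := hFx 0 (by simp)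
      exact ⟨⟨c, hc⟩, fun h => absurd h hx⟩
  choose κ hκ using hκ_ex
  obtain ⟨L, hL⟩ := hobs.exists_leftInverse
  obtain ⟨c, hc, hAc⟩ := (A ^ T).exists_norm_mulVec_le
  exact ⟨CoderEstimator.zoom A L (T := T) (by omega) (c + 2) κ (fun μ => e μ) dec,
    CoderEstimator.zoom_uniformlyBoundedErrors (by omega) (by omega) hL hc.le hAc le_rfl hκ
      fun z hz μ t₀ => hdec _ z hz μ t₀ rfl⟩

end

theorem proposition2 {n m : ℕ} {X S : Type*} [Fintype X] [Fintype S] [Nonempty S]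
    (hq : 2 ≤ Fintype.card X)
    (A : Matrix (Fin n) (Fin n) ℝ) (C : Matrix (Fin m) (Fin n) ℝ)
    (hobs : LTI.Observable C A)
    (hunst : ∃ z ∈ LTI.eigenvalues A, 1 < ‖z‖)
    (ch : FiniteStateErasureChannel S) :
    (LTI.topologicalEntropy A (Fintype.card X) + ch.topologicalEntropy (Fintype.card X)
        + ch.maximalRatio < 1 →
      ∃ ce : CoderEstimator n m X, ce.UniformlyBoundedErrors A C ch) ∧
    (1 < LTI.topologicalEntropy A (Fintype.card X) + ch.maximalRatio →
      ∀ (RV : Set (ℕ → Fin n → ℝ)) (RW : Set (ℕ → Fin m → ℝ)),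
        LTI.UniformlyBoundedSignals RV → LTI.UniformlyBoundedSignals RW →
        0 ∈ RV → 0 ∈ RW →
        ∃ v ∈ RV, ∃ w ∈ RW, ∀ (ce : CoderEstimator n m X) (l : ℝ), 0 < l →
          ∃ x₀ ∈ Metric.closedBall (0 : Fin n → ℝ) l, ∃ z ∈ ch.noiseSequences,
            ¬ BddAbove (Set.range fun t => ‖ce.estimationError A C x₀ v w z t‖)) := by
  refine ⟨exists_uniformlyBoundedErrors hq hobs ch, fun h RV RW _ _ hV hW => ?_⟩
  exact ⟨0, hV, 0, hW, fun ce l hl => exists_unbounded_estimationError hq A C ch h ce hl⟩
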